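/- Let $(M,J)$ be an almost complex manifold and let $(N^{2n},h)$ be a Riemannian manifold with Levi-Civita connection $\nabla^h$ (all manifolds, maps and tensors are smooth, and manifolds are Hausdorff and second countable). **Twistor spaces.** Let $\pi:\mathcal J(N)\to N$ be the bundle with fibres $\mathcal J_x(N)=\{j\in \mathrm{End}(T_xN)\mid j^2=-\mathrm{id},\ h(j\cdot,\cdot)=-h(\cdot,j\cdot)\}$, let $T\mathcal J(N)=\mathcal H\oplus\mathcal V$, $\mathcal V=\ker d\pi$, be the splitting induced by $\nabla^h$, and let $J^{\mathcal V}$ be the complex structure of the fibres, $J^{\mathcal V}A=jA$ for $A\in\mathcal V_j=\{A\in\mathrm{End}(T_{\pi(j)}N)\mid A \text{ skew-symmetric},\ Aj=-jA\}$. A twistor space over $N$ is a complex manifold $\mathcal Z$ with a submersion $p:\mathcal Z\to N$ whose fibres are complex submanifolds, a horizontal distribution $\mathcal H^{\mathcal Z}$ (so that $T\mathcal Z=\mathcal H^{\mathcal Z}\oplus\ker dp$), and a map $i:\mathcal Z\to\mathcal J(N)$ with $\pi\circ i=p$ which is holomorphic between the fibres and satisfies $di(\mathcal H^{\mathcal Z})\subset\mathcal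 H$. On $\mathcal Z$ let $J_2^{\mathcal Z}$ be the almost complex structure that is minus the complex structure of the fibres on $\ker dp$, preserves $\mathcal H^{\mathcal Z}$, and corresponds on $\mathcal H^{\mathcal Z}_z\cong T_{p(z)}N$ (via $dp$) to the endomorphism $i(z)$. **Generalized pluriharmonic maps.** A connection $D$ on $TM$ is of Nijenhuis type if $DJ=0$ and its torsion $T$ satisfies $T^{1,1}=0$. Here the $(1,1)$-part of a bilinear map $B$ is $B^{1,1}(X,Y)=\tfrac12\big(B(X,Y)+B(JX,JY)\big)$; it vanishes if and only if the complex bilinear extension satisfies $B(Z,\overline W)=B(\overline W,Z)=0$ for all $Z,W\in T^{1,0}M$. A smooth map $\varphi:M\to N$ is generalized pluriharmonic if $(\nabla d\varphi)^{1,1}=0$, where $(\nabla d\varphi)(X,Y)=(\varphi^*\nabla^h)_X(d\varphi\,Y)-d\varphi(D_XY)$ for a connection $D$ of Nijenhuis type; this condition does not depend on the choice of $D$, and it is understood here as holding for every such $D$. **Theorem.** Let $p:\mathcal Z\to N$ be a twistor space over $(N,h)$ and let $\psi:M\to\mathcal Z$ be $J_2^{\mathcal Z}$-holomorphic, i.e.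 a smooth map with $d\psi\circ J=J_2^{\mathcal Z}\circ d\psi$. Then $\varphi=p\circ\psi:(M,J)\to(N,h)$ is generalized pluriharmonic, i.e. $(\nabla d\varphi)^{1,1}=0$. -/

import Mathlib

open Bundle Manifold FiberBundle
open scoped ContDiff

set_option linter.unusedSectionVars false
set_option linter.style.haveILetI false

noncomputable section

namespace TwistorGeom

section LeviCivita

variable {E : Type*} [NormedAddCommGroup E] [NormedSpace ℝ E] [FiniteDimensional ℝ E]
  {N : Type*} [TopologicalSpace N] [ChartedSpace E N] [IsManifold 𝓘(ℝ, E) ∞ N]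
  [RiemannianBundle (fun x : N ↦ TangentSpace 𝓘(ℝ, E) x)]

/-- The right-hand side of the Koszul formula
`2 ⟨∇_X Y, Z⟩ = X⟨Y, Z⟩ + Y⟨X, Z⟩ - Z⟨X, Y⟩ + ⟨[X, Y], Z⟩ - ⟨[X, Z], Y⟩ - ⟨[Y, Z], X⟩`. -/
def koszul (Y X Z : Π x : N, TangentSpace 𝓘(ℝ, E) x) (x : N) : ℝ :=
  mvfderiv 𝓘(ℝ, E) (fun y ↦ inner ℝ (Y y) (Z y)) x (X x)
    + mvfderiv 𝓘(ℝ, E) (fun y ↦ inner ℝ (X y) (Z y)) x (Y x)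
    - mvfderiv 𝓘(ℝ, E) (fun y ↦ inner ℝ (X y) (Y y)) x (Z x)
    + inner ℝ (VectorField.mlieBracket 𝓘(ℝ, E) X Y x) (Z x)
    - inner ℝ (VectorField.mlieBracket 𝓘(ℝ, E) X Z x) (Y x)
    - inner ℝ (VectorField.mlieBracket 𝓘(ℝ, E) Y Z x) (X x)

variable [IsContMDiffRiemannianBundle 𝓘(ℝ, E) ∞ E (fun x : N ↦ TangentSpace 𝓘(ℝ, E) x)]

theorem mdifferentiableAt_inner {x : N} {X Y : Π x : N, TangentSpace 𝓘(ℝ, E) x}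
    (hX : MDiffAt (T% X) x) (hY : MDiffAt (T% Y) x) :
    MDiffAt (fun y ↦ (inner ℝ (X y) (Y y) : ℝ)) x :=
  MDifferentiableAt.inner_bundle (F := E) (E := fun x : N ↦ TangentSpace 𝓘(ℝ, E) x)
    (b := fun y ↦ y) hX hY

theorem koszul_tensorial_left {x : N} {Y Z : Π x : N, TangentSpace 𝓘(ℝ, E) x}
    (hY : MDiffAt (T% Y) x) (hZ : MDiffAt (T% Z) x) :
    TensorialAt 𝓘(ℝ, E) E (fun X ↦ koszul Y X Z x) x where
  smul {f X} hf hX := by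
    have h1 := mvfderiv_fun_mul hf (mdifferentiableAt_inner hX hZ)
    have h2 := mvfderiv_fun_mul hf (mdifferentiableAt_inner hX hY)
    simp only [koszul, Pi.smul_apply', real_inner_smul_left, h1, h2,
      VectorField.mlieBracket_smul_left hf hX, inner_add_left, real_inner_smul_right]
    simp
    ring
  add {X X'} hX hX' := by
    have h1 := mvfderiv_fun_add (mdifferentiableAt_inner hX hZ) (mdifferentiableAt_inner hX' hZ)
    have h2 := mvfderiv_fun_add (mdifferentiableAt_inner hX hY) (mdifferentiableAt_inner hX' hY)
    simp only [koszul, Pi.add_apply, inner_add_left, h1, h2,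
      VectorField.mlieBracket_add_left hX hX', inner_add_right]
    simp
    ring

theorem koszul_tensorial_right {x : N} {Y X : Π x : N, TangentSpace 𝓘(ℝ, E) x}
    (hY : MDiffAt (T% Y) x) (hX : MDiffAt (T% X) x) :
    TensorialAt 𝓘(ℝ, E) E (fun Z ↦ koszul Y X Z x) x where
  smul {f Z} hf hZ := by
    have h1 := mvfderiv_fun_mul hf (mdifferentiableAt_inner hY hZ)
    have h2 := mvfderiv_fun_mul hf (mdifferentiableAt_inner hX hZ)
    simp only [koszul, Pi.smul_apply', real_inner_smul_right, h1, h2,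
      VectorField.mlieBracket_smul_right hf hZ, inner_add_left, real_inner_smul_left]
    simp only [add_apply, smul_apply, smul_eq_mul, map_smul]
    rw [real_inner_comm (Z x) (Y x), real_inner_comm (Z x) (X x)]
    ring
  add {Z Z'} hZ hZ' := by
    have h1 := mvfderiv_fun_add (mdifferentiableAt_inner hY hZ) (mdifferentiableAt_inner hY hZ')
    have h2 := mvfderiv_fun_add (mdifferentiableAt_inner hX hZ) (mdifferentiableAt_inner hX hZ')
    simp only [koszul, Pi.add_apply, inner_add_right, h1, h2,
      VectorField.mlieBracket_add_right hZ hZ', inner_add_left]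
    simp
    ring

theorem koszul_add {x : N} {Y Y' X Z : Π x : N, TangentSpace 𝓘(ℝ, E) x}
    (hX : MDiffAt (T% X) x) (hY : MDiffAt (T% Y) x) (hY' : MDiffAt (T% Y') x)
    (hZ : MDiffAt (T% Z) x) :
    koszul (Y + Y') X Z x = koszul Y X Z x + koszul Y' X Z x := by
  have h1 := mvfderiv_fun_add (mdifferentiableAt_inner hY hZ) (mdifferentiableAt_inner hY' hZ)
  have h2 := mvfderiv_fun_add (mdifferentiableAt_inner hX hY) (mdifferentiableAt_inner hX hY')
  simp only [koszul, Pi.add_apply, inner_add_left, inner_add_right, h1, h2,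
    VectorField.mlieBracket_add_left hY hY', VectorField.mlieBracket_add_right hY hY']
  simp
  ring

theorem koszul_smul {x : N} {Y X Z : Π x : N, TangentSpace 𝓘(ℝ, E) x} {f : N → ℝ}
    (hf : MDiffAt f x)
    (hX : MDiffAt (T% X) x) (hY : MDiffAt (T% Y) x) (hZ : MDiffAt (T% Z) x) :
    koszul (f • Y) X Z x =
      f x * koszul Y X Z x + 2 * (mvfderiv 𝓘(ℝ, E) f x (X x) * inner ℝ (Y x) (Z x)) := by
  have h1 := mvfderiv_fun_mul hf (mdifferentiableAt_inner hY hZ)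
  have h2 := mvfderiv_fun_mul hf (mdifferentiableAt_inner hX hY)
  simp only [koszul, Pi.smul_apply', real_inner_smul_left, real_inner_smul_right, h1, h2,
    VectorField.mlieBracket_smul_left hf hY, VectorField.mlieBracket_smul_right hf hY,
    inner_add_left]
  simp only [add_apply, smul_apply, smul_eq_mul, map_smul,
    neg_mul]
  rw [real_inner_comm (X x) (Y x)]
  ring

open Classical in
/-- The covariant derivative determined by the Koszul formula: `∇_v Y` is the Riesz representative
of half the Koszul functional (and the junk value `0` where `Y` is not differentiable). -/
def leviCivitaFun (Y : Π x : N, TangentSpace 𝓘(ℝ, E) x) (x : N) :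
    TangentSpace 𝓘(ℝ, E) x →L[ℝ] TangentSpace 𝓘(ℝ, E) x :=
  haveI : FiniteDimensional ℝ (TangentSpace 𝓘(ℝ, E) x) :=
    inferInstanceAs (FiniteDimensional ℝ E)
  haveI : CompleteSpace (TangentSpace 𝓘(ℝ, E) x) := FiniteDimensional.complete ℝ _
  if hY : MDiffAt (T% Y) x then
    LinearMap.toContinuousLinearMap
      { toFun v := (1 / 2 : ℝ) • (InnerProductSpace.toDual ℝ (TangentSpace 𝓘(ℝ, E) x)).symm
          (TensorialAt.mkHom₂ (I := 𝓘(ℝ, E)) (F := E) (F' := E) (fun X Z ↦ koszul Y X Z x) x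
            (fun _ hZ ↦ koszul_tensorial_left hY hZ) (fun _ hX ↦ koszul_tensorial_right hY hX) v)
        map_add' v w := by simp
        map_smul' c v := by
          simp only [map_smul, RingHom.id_apply]
          rw [smul_comm] }
  else 0

theorem inner_leviCivitaFun {x : N} {X Y Z : Π x : N, TangentSpace 𝓘(ℝ, E) x}
    (hX : MDiffAt (T% X) x) (hY : MDiffAt (T% Y) x) (hZ : MDiffAt (T% Z) x) :
    inner ℝ (leviCivitaFun Y x (X x)) (Z x) = (1 / 2 : ℝ) * koszul Y X Z x := by
  haveI : FiniteDimensional ℝ (TangentSpace 𝓘(ℝ, E) x) :=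
      inferInstanceAs (FiniteDimensional ℝ E)
  haveI : CompleteSpace (TangentSpace 𝓘(ℝ, E) x) := FiniteDimensional.complete ℝ _
  simp only [leviCivitaFun, dif_pos hY]
  rw [LinearMap.coe_toContinuousLinearMap', LinearMap.coe_mk, AddHom.coe_mk, real_inner_smul_left,
    InnerProductSpace.toDual_symm_apply, TensorialAt.mkHom₂_apply _ _ hX hZ]

theorem tangent_ext {x : N} {A B : TangentSpace 𝓘(ℝ, E) x →L[ℝ] TangentSpace 𝓘(ℝ, E) x}
    (h : ∀ X Z : Π x : N, TangentSpace 𝓘(ℝ, E) x, MDiffAt (T% X) x → MDiffAt (T% Z) x →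
      (inner ℝ (A (X x)) (Z x) : ℝ) = inner ℝ (B (X x)) (Z x)) : A = B := by
  ext v
  refine ext_inner_right ℝ fun w ↦ ?_
  simpa using h (extend E v) (extend E w) (mdifferentiableAt_extend ..)
    (mdifferentiableAt_extend ..)

variable (E N) in
/-- The Levi-Civita connection of the Riemannian metric of `N`. It is torsion-free
(`leviCivita_torsion`) and metric (`leviCivita_metric`). -/
def leviCivita : CovariantDerivative 𝓘(ℝ, E) E (TangentSpace 𝓘(ℝ, E) : N → Type _) where
  toFun := leviCivitaFun
  isCovariantDerivativeOnUniv :=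
    { add := by
        intro Y Y' x hY hY' _
        refine tangent_ext fun X Z hX hZ ↦ ?_
        have hS : MDiffAt (T% (Y + Y')) x := mdifferentiableAt_add_section hY hY'
        rw [add_apply, inner_add_left, inner_leviCivitaFun hX hS hZ,
          inner_leviCivitaFun hX hY hZ, inner_leviCivitaFun hX hY' hZ, koszul_add hX hY hY' hZ]
        ring
      leibniz := by
        intro Y f x hY hf _
        refine tangent_ext fun X Z hX hZ ↦ ?_
        have hS : MDiffAt (T% (f • Y)) x := hf.smul_section hY
        rw [add_apply, inner_add_left, inner_leviCivitaFun hX hS hZ,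
          smul_apply, real_inner_smul_left, inner_leviCivitaFun hX hY hZ,
          koszul_smul hf hX hY hZ, ContinuousLinearMap.smulRight_apply, real_inner_smul_left]
        ring }

theorem leviCivita_torsion : (leviCivita E N).torsion = 0 := by
  rw [CovariantDerivative.torsion_eq_zero_iff]
  intro X Y x hX hY
  refine ext_inner_right ℝ fun w ↦ ?_
  have hZ : MDiffAt (T% (extend E w)) x := mdifferentiableAt_extend ..
  have h1 := inner_leviCivitaFun hX hY hZ
  have h2 := inner_leviCivitaFun hY hX hZ
  rw [extend_apply_self] at h1 h2
  change (inner ℝ (leviCivitaFun Y x (X x) - leviCivitaFun X x (Y x)) w : ℝ) = _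
  rw [inner_sub_left, h1, h2]
  simp only [koszul, extend_apply_self, real_inner_comm]
  rw [VectorField.mlieBracket_swap (V := Y) (W := X)]
  simp only [Pi.neg_apply, inner_neg_right]
  ring

theorem leviCivita_metric {x : N} {X Y Z : Π x : N, TangentSpace 𝓘(ℝ, E) x}
    (hX : MDiffAt (T% X) x) (hY : MDiffAt (T% Y) x) (hZ : MDiffAt (T% Z) x) :
    mvfderiv 𝓘(ℝ, E) (fun y ↦ (inner ℝ (Y y) (Z y) : ℝ)) x (X x) =
      inner ℝ (leviCivita E N Y x (X x)) (Z x) + inner ℝ (Y x) (leviCivita E N Z x (X x)) := by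
  have h1 := inner_leviCivitaFun hX hY hZ
  have h2 := inner_leviCivitaFun hX hZ hY
  change _ = (inner ℝ (leviCivitaFun Y x (X x)) (Z x) : ℝ)
    + inner ℝ (Y x) (leviCivitaFun Z x (X x))
  rw [real_inner_comm (leviCivitaFun Z x (X x)), h1, h2]
  simp only [koszul, real_inner_comm]
  rw [VectorField.mlieBracket_swap (V := Z) (W := Y)]
  simp only [Pi.neg_apply, inner_neg_right]
  ring

end LeviCivita

section Connections

variable {EM : Type*} [NormedAddCommGroup EM] [NormedSpace ℝ EM] [FiniteDimensional ℝ EM]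
  {M : Type*} [TopologicalSpace M] [ChartedSpace EM M] [IsManifold 𝓘(ℝ, EM) ∞ M]
  {E : Type*} [NormedAddCommGroup E] [NormedSpace ℝ E] [FiniteDimensional ℝ E]
  {N : Type*} [TopologicalSpace N] [ChartedSpace E N] [IsManifold 𝓘(ℝ, E) ∞ N]

/-- The pull-back connection `f^*∇` on `f^*TN`: for a section `s` of `TN` along `f`, written in the
frame of the preferred trivialization at `f m` as `s = ∑ sᵃ (e_a ∘ f)`, one has
`(f^*∇)_v s = ∑ dsᵃ(v) e_a + ∇_{df(v)} (∑ sᵃ(m) e_a)`. Here `extend E w` is the local extension of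
the vector `w` with constant coefficients in this frame. -/
def pullbackDeriv (cov : CovariantDerivative 𝓘(ℝ, E) E (TangentSpace 𝓘(ℝ, E) : N → Type _))
    (f : M → N) (s : Π m : M, TangentSpace 𝓘(ℝ, E) (f m)) (m : M) :
    TangentSpace 𝓘(ℝ, EM) m →L[ℝ] TangentSpace 𝓘(ℝ, E) (f m) :=
  letI e := trivializationAt E (TangentSpace 𝓘(ℝ, E) : N → Type _) (f m)
  (e.symmL ℝ (f m)) ∘L mvfderiv 𝓘(ℝ, EM) (fun m' ↦ (e ⟨f m', s m'⟩).2) m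
    + cov (extend E (s m)) (f m) ∘L mfderiv 𝓘(ℝ, EM) 𝓘(ℝ, E) f m

theorem cov_tensorial (cov : CovariantDerivative 𝓘(ℝ, E) E (TangentSpace 𝓘(ℝ, E) : N → Type _))
    (x : N) : TensorialAt 𝓘(ℝ, E) E (fun Y : Π x : N, TangentSpace 𝓘(ℝ, E) x ↦
      letI e := trivializationAt E (TangentSpace 𝓘(ℝ, E) : N → Type _) x
      cov Y x - e.symmL ℝ x ∘L mvfderiv 𝓘(ℝ, E) (fun y ↦ (e ⟨y, Y y⟩).2) x) x where
  smul {f Y} hf hY := by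
    let e := trivializationAt E (TangentSpace 𝓘(ℝ, E) : N → Type _) x
    have hb : x ∈ e.baseSet := FiberBundle.mem_baseSet_trivializationAt' x
    have hY' := (mdifferentiableAt_section _ Y).1 hY
    have h : (fun y ↦ (e ⟨y, (f • Y) y⟩).2) =ᶠ[nhds x] (fun y ↦ f y • (e ⟨y, Y y⟩).2) := by
      filter_upwards [e.open_baseSet.mem_nhds hb] with y hy
      exact (e.linear ℝ hy).map_smul _ _
    have h2 := mvfderiv_fun_smul hf hY'
    have h3 : mvfderiv 𝓘(ℝ, E) (fun y ↦ (e ⟨y, (f • Y) y⟩).2) x = mvfderiv 𝓘(ℝ, E) (fun y ↦ f y • (e ⟨y, Y y⟩).2) x := by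
      ext v
      change mfderiv 𝓘(ℝ, E) 𝓘(ℝ, E) (fun y ↦ (e ⟨y, (f • Y) y⟩).2) x v = mfderiv 𝓘(ℝ, E) 𝓘(ℝ, E) (fun y ↦ f y • (e ⟨y, Y y⟩).2) x v
      rw [h.mfderiv_eq]; rfl
    change _ - e.symmL ℝ x ∘L mvfderiv 𝓘(ℝ, E) (fun y ↦ (e ⟨y, (f • Y) y⟩).2) x = _
    rw [h3, h2, cov.isCovariantDerivativeOn.leibniz (s := Set.univ) hY hf]
    ext v
    have : e.symmL ℝ x (e ⟨x, Y x⟩).2 = Y x := by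
      rw [e.symmL_apply hb]; exact e.symm_apply_apply_mk hb _
    simp [smul_sub]
    erw [this]
    abel
  add {Y Y'} hY hY' := by
    let e := trivializationAt E (TangentSpace 𝓘(ℝ, E) : N → Type _) x
    have hb : x ∈ e.baseSet := FiberBundle.mem_baseSet_trivializationAt' x
    have h : (fun y ↦ (e ⟨y, (Y + Y') y⟩).2) =ᶠ[nhds x] (fun y ↦ (e ⟨y, Y y⟩).2 + (e ⟨y, Y' y⟩).2) := by
      filter_upwards [e.open_baseSet.mem_nhds hb] with y hy
      exact (e.linear ℝ hy).map_add _ _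
    have h2 := mvfderiv_fun_add ((mdifferentiableAt_section _ Y).1 hY) ((mdifferentiableAt_section _ Y').1 hY')
    have h3 : mvfderiv 𝓘(ℝ, E) (fun y ↦ (e ⟨y, (Y + Y') y⟩).2) x = mvfderiv 𝓘(ℝ, E) (fun y ↦ (e ⟨y, Y y⟩).2 + (e ⟨y, Y' y⟩).2) x := by
      ext v
      change mfderiv 𝓘(ℝ, E) 𝓘(ℝ, E) (fun y ↦ (e ⟨y, (Y + Y') y⟩).2) x v = mfderiv 𝓘(ℝ, E) 𝓘(ℝ, E) (fun y ↦ (e ⟨y, Y y⟩).2 + (e ⟨y, Y' y⟩).2) x v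
      rw [h.mfderiv_eq]; rfl
    change _ - e.symmL ℝ x ∘L mvfderiv 𝓘(ℝ, E) (fun y ↦ (e ⟨y, (Y + Y') y⟩).2) x = _
    rw [h3, h2, cov.isCovariantDerivativeOn.add (s := Set.univ) hY hY']
    ext v
    simp
    abel

/-- A connection in the preferred trivialization at `x`. -/
theorem cov_eq (cov : CovariantDerivative 𝓘(ℝ, E) E (TangentSpace 𝓘(ℝ, E) : N → Type _))
    (x : N) (Y : Π x : N, TangentSpace 𝓘(ℝ, E) x) (hY : MDiffAt (T% Y) x) :
    letI e := trivializationAt E (TangentSpace 𝓘(ℝ, E) : N → Type _) x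
    cov Y x = e.symmL ℝ x ∘L mvfderiv 𝓘(ℝ, E) (fun y ↦ (e ⟨y, Y y⟩).2) x + cov (extend E (Y x)) x := by
  let e := trivializationAt E (TangentSpace 𝓘(ℝ, E) : N → Type _) x
  have hb : x ∈ e.baseSet := FiberBundle.mem_baseSet_trivializationAt' x
  have h := (cov_tensorial cov x).pointwise hY (mdifferentiableAt_extend (σ₀ := Y x) ..) (by simp)
  have h0 : mvfderiv 𝓘(ℝ, E) (fun y ↦ (e ⟨y, extend E (Y x) y⟩).2) x = 0 := by
    have : (fun y ↦ (e ⟨y, extend E (Y x) y⟩).2) =ᶠ[nhds x] fun _ ↦ (e ⟨x, Y x⟩).2 := by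
      filter_upwards [e.open_baseSet.mem_nhds hb] with y hy
      change (e ⟨y, e.symm y _⟩).2 = _
      rw [e.apply_mk_symm hy]
    ext v
    change mfderiv 𝓘(ℝ, E) 𝓘(ℝ, E) (fun y ↦ (e ⟨y, extend E (Y x) y⟩).2) x v = 0
    rw [this.mfderiv_eq, mfderiv_const]; rfl
  change cov Y x - e.symmL ℝ x ∘L mvfderiv 𝓘(ℝ, E) (fun y ↦ (e ⟨y, Y y⟩).2) x =
    cov (extend E (Y x)) x - e.symmL ℝ x ∘L mvfderiv 𝓘(ℝ, E) (fun y ↦ (e ⟨y, extend E (Y x) y⟩).2) x at h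
  rw [h0, ContinuousLinearMap.comp_zero, sub_zero] at h
  rw [← h]; abel

/-- The defining property of the pull-back connection: `(f^*∇)_v (Y ∘ f) = ∇_{df(v)} Y`. -/
theorem pullbackDeriv_comp (cov : CovariantDerivative 𝓘(ℝ, E) E (TangentSpace 𝓘(ℝ, E) : N → Type _))
    {f : M → N} {m : M} (hf : MDifferentiableAt 𝓘(ℝ, EM) 𝓘(ℝ, E) f m)
    {Y : Π x : N, TangentSpace 𝓘(ℝ, E) x} (hY : MDiffAt (T% Y) (f m)) :
    pullbackDeriv cov f (fun m' ↦ Y (f m')) m = cov Y (f m) ∘L mfderiv 𝓘(ℝ, EM) 𝓘(ℝ, E) f m := by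
  rw [cov_eq cov _ Y hY]
  have h := (mdifferentiableAt_section (F := E) (E := (TangentSpace 𝓘(ℝ, E) : N → Type _)) _ Y).1 hY
  have h1 := mfderiv_comp m h hf
  ext v
  have h2 := congr($h1 v)
  simp only [pullbackDeriv, add_apply, ContinuousLinearMap.comp_apply]
  exact congrArg (fun t ↦ Trivialization.symmL ℝ
    (trivializationAt E (TangentSpace 𝓘(ℝ, E) : N → Type _) (f m)) (f m) t +
      cov (extend E (Y (f m))) (f m) (mfderiv 𝓘(ℝ, EM) 𝓘(ℝ, E) f m v)) h2

theorem extend_add_eventuallyEq {x : N} (v w : TangentSpace 𝓘(ℝ, E) x) :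
    ∀ᶠ y in nhds x, extend E (v + w) y = (extend E v + extend E w) y := by
  let e := trivializationAt E (TangentSpace 𝓘(ℝ, E) : N → Type _) x
  have hb : x ∈ e.baseSet := FiberBundle.mem_baseSet_trivializationAt' x
  filter_upwards [e.open_baseSet.mem_nhds hb] with y hy
  change e.symm y (e ⟨x, v + w⟩).2 = e.symm y (e ⟨x, v⟩).2 + e.symm y (e ⟨x, w⟩).2
  simp only [← Trivialization.symmₗ_apply (R := ℝ) e hy]
  rw [← map_add]
  exact congrArg _ ((e.linear ℝ hb).map_add v w)

theorem extend_smul_eventuallyEq {x : N} (c : ℝ) (v : TangentSpace 𝓘(ℝ, E) x) :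
    ∀ᶠ y in nhds x, extend E (c • v) y = (c • extend E v) y := by
  let e := trivializationAt E (TangentSpace 𝓘(ℝ, E) : N → Type _) x
  have hb : x ∈ e.baseSet := FiberBundle.mem_baseSet_trivializationAt' x
  filter_upwards [e.open_baseSet.mem_nhds hb] with y hy
  change e.symm y (e ⟨x, c • v⟩).2 = c • e.symm y (e ⟨x, v⟩).2
  simp only [← Trivialization.symmₗ_apply (R := ℝ) e hy]
  rw [← map_smul]
  exact congrArg _ ((e.linear ℝ hb).map_smul c v)

/-- The connection form `Γ(u) = (w ↦ ∇_u (∑ wᵃ e_a))` of `∇` at `x`, with respect to the frame of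
the preferred trivialization at `x`. -/
def connectionForm (cov : CovariantDerivative 𝓘(ℝ, E) E (TangentSpace 𝓘(ℝ, E) : N → Type _))
    (x : N) (u : TangentSpace 𝓘(ℝ, E) x) :
    TangentSpace 𝓘(ℝ, E) x →L[ℝ] TangentSpace 𝓘(ℝ, E) x :=
  haveI : FiniteDimensional ℝ (TangentSpace 𝓘(ℝ, E) x) :=
    inferInstanceAs (FiniteDimensional ℝ E)
  haveI : T2Space (TangentSpace 𝓘(ℝ, E) x) := inferInstanceAs (T2Space E)
  LinearMap.toContinuousLinearMap
    { toFun w := cov (extend E w) x u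
      map_add' v w := by
        rw [cov.isCovariantDerivativeOn.congr_of_eventuallyEq (s := Set.univ)
          (mdifferentiableAt_extend ..) (mdifferentiableAt_add_section
            (mdifferentiableAt_extend ..) (mdifferentiableAt_extend ..)) Filter.univ_mem
          (extend_add_eventuallyEq v w), cov.isCovariantDerivativeOn.add (s := Set.univ)
          (mdifferentiableAt_extend ..) (mdifferentiableAt_extend ..)]
        rfl
      map_smul' c v := by
        rw [cov.isCovariantDerivativeOn.congr_of_eventuallyEq (s := Set.univ)
          (mdifferentiableAt_extend ..) (mdifferentiableAt_const.smul_section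
            (mdifferentiableAt_extend ..)) Filter.univ_mem
          (extend_smul_eventuallyEq c v)]
        change cov (c • extend E v) x u = _
        rw [cov.isCovariantDerivativeOn.smul_const (s := Set.univ) c (mdifferentiableAt_extend ..)]
        rfl }

/-- The total space of the vector bundle `End(TN)` over `N`. -/
abbrev EndTangent (E : Type*) [NormedAddCommGroup E] [NormedSpace ℝ E]
  (N : Type*) [TopologicalSpace N] [ChartedSpace E N] [IsManifold 𝓘(ℝ, E) ∞ N] : Type _ :=
  TotalSpace (E →L[ℝ] E)
    (fun x : N ↦ TangentSpace 𝓘(ℝ, E) x →L[ℝ] TangentSpace 𝓘(ℝ, E) x)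

/-- The vertical component of a tangent vector `ξ` of the total space of `End(TN)` with respect to
the connection induced by `∇` on `End(TN)`; as the fibre is a vector space, the vertical component
is an endomorphism of the tangent space. If `ξ` is the velocity of a curve `A(t)` of endomorphisms,
it is `∇A/dt`, that is `A' + [Γ, A]` in the preferred trivialization at the base point. -/
def connector (cov : CovariantDerivative 𝓘(ℝ, E) E (TangentSpace 𝓘(ℝ, E) : N → Type _))
    (a : EndTangent E N)
    (ξ : TangentSpace (𝓘(ℝ, E).prod 𝓘(ℝ, E →L[ℝ] E)) a) :
    TangentSpace 𝓘(ℝ, E) a.proj →L[ℝ] TangentSpace 𝓘(ℝ, E) a.proj :=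
  letI e := trivializationAt (E →L[ℝ] E)
    (fun x : N ↦ TangentSpace 𝓘(ℝ, E) x →L[ℝ] TangentSpace 𝓘(ℝ, E) x) a.proj
  letI Γ := connectionForm cov a.proj
    (mfderiv (𝓘(ℝ, E).prod 𝓘(ℝ, E →L[ℝ] E)) 𝓘(ℝ, E) (fun b : EndTangent E N ↦ b.proj) a ξ)
  e.symmL ℝ a.proj (mvfderiv (𝓘(ℝ, E).prod 𝓘(ℝ, E →L[ℝ] E)) (fun b ↦ (e b).2) a ξ)
    + (Γ ∘L a.snd - a.snd ∘L Γ)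

end Connections

section Pluriharmonic

variable {EM : Type*} [NormedAddCommGroup EM] [NormedSpace ℝ EM] [FiniteDimensional ℝ EM]
  {M : Type*} [TopologicalSpace M] [ChartedSpace EM M] [IsManifold 𝓘(ℝ, EM) ∞ M]
  {E : Type*} [NormedAddCommGroup E] [NormedSpace ℝ E] [FiniteDimensional ℝ E]
  {N : Type*} [TopologicalSpace N] [ChartedSpace E N] [IsManifold 𝓘(ℝ, E) ∞ N]

/-- A (smooth) almost complex structure on the manifold `M`. -/
structure AlmostComplexStructure (EM : Type*) [NormedAddCommGroup EM] [NormedSpace ℝ EM]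
    (M : Type*) [TopologicalSpace M] [ChartedSpace EM M] [IsManifold 𝓘(ℝ, EM) ∞ M] where
  /-- The endomorphism field. -/
  J : Π x : M, TangentSpace 𝓘(ℝ, EM) x →L[ℝ] TangentSpace 𝓘(ℝ, EM) x
  sq : ∀ (x : M) (v : TangentSpace 𝓘(ℝ, EM) x), J x (J x v) = -v
  smooth : ContMDiff 𝓘(ℝ, EM) (𝓘(ℝ, EM).prod 𝓘(ℝ, EM →L[ℝ] EM)) ∞
    (fun x ↦ (⟨x, J x⟩ : EndTangent EM M))

/-- The `(1,1)`-part `½ (B(X, Y) + B(J X, J Y))` of a real bilinear map `B`. For the complex bilinear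
extension of `B`, it vanishes for all `X`, `Y` if and only if `B(Z, W̄) = B(W̄, Z) = 0` for all
vectors `Z`, `W` of type `(1,0)`. -/
def oneOnePart {V W : Type*} [AddCommGroup W] [Module ℝ W] (J : V → V) (B : V → V → W)
    (X Y : V) : W :=
  (1 / 2 : ℝ) • (B X Y + B (J X) (J Y))

/-- `D` is a connection of Nijenhuis type on `(M, J)`: it is complex, `D J = 0`, and the
`(1,1)`-part of its torsion vanishes. -/
structure IsNijenhuisType (J : AlmostComplexStructure EM M)
    (D : CovariantDerivative 𝓘(ℝ, EM) EM (TangentSpace 𝓘(ℝ, EM) : M → Type _)) : Prop where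
  complex : ∀ (Y : Π x : M, TangentSpace 𝓘(ℝ, EM) x) (x : M), MDiffAt (T% Y) x →
    ∀ v : TangentSpace 𝓘(ℝ, EM) x, D (fun y ↦ J.J y (Y y)) x v = J.J x (D Y x v)
  torsion : ∀ (x : M) (u v : TangentSpace 𝓘(ℝ, EM) x),
    oneOnePart (J.J x) (fun u v ↦ D.torsion x u v) u v = 0

/-- The second fundamental form `(∇dφ)(X, Y) = (φ^*∇^N)_X (dφ Y) - dφ(D_X Y)` of a map
`φ : M → N`, for vector fields `X`, `Y`, a connection `D` on `M` and a connection `∇^N` on `N`. -/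
def secondFundamentalForm
    (D : CovariantDerivative 𝓘(ℝ, EM) EM (TangentSpace 𝓘(ℝ, EM) : M → Type _))
    (cov : CovariantDerivative 𝓘(ℝ, E) E (TangentSpace 𝓘(ℝ, E) : N → Type _)) (φ : M → N)
    (X Y : Π x : M, TangentSpace 𝓘(ℝ, EM) x) : Π x : M, TangentSpace 𝓘(ℝ, E) (φ x) :=
  fun x ↦ pullbackDeriv cov φ (fun y ↦ mfderiv 𝓘(ℝ, EM) 𝓘(ℝ, E) φ y (Y y)) x (X x)
    - mfderiv 𝓘(ℝ, EM) 𝓘(ℝ, E) φ x (D Y x (X x))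

variable [RiemannianBundle (fun x : N ↦ TangentSpace 𝓘(ℝ, E) x)]
  [IsContMDiffRiemannianBundle 𝓘(ℝ, E) ∞ E (fun x : N ↦ TangentSpace 𝓘(ℝ, E) x)]

/-- `φ : (M, J) → (N, h)` is generalized pluriharmonic: it is smooth and `(∇dφ)^{1,1} = 0`, where
`∇` is induced by a connection `D` of Nijenhuis type on `(M, J)` and the Levi-Civita connection of
`N`. The equation does not depend on the choice of `D`; it is required for every `D`. -/
structure IsGeneralizedPluriharmonic (J : AlmostComplexStructure EM M) (φ : M → N) : Prop where
  smooth : ContMDiff 𝓘(ℝ, EM) 𝓘(ℝ, E) ∞ φ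
  eq_zero : ∀ D : CovariantDerivative 𝓘(ℝ, EM) EM (TangentSpace 𝓘(ℝ, EM) : M → Type _),
    IsNijenhuisType J D → ∀ X Y : Π x : M, TangentSpace 𝓘(ℝ, EM) x,
      CMDiff ∞ (T% X) → CMDiff ∞ (T% Y) → ∀ x : M,
        oneOnePart (fun (V : Π x : M, TangentSpace 𝓘(ℝ, EM) x) x ↦ J.J x (V x))
          (secondFundamentalForm D (leviCivita E N) φ) X Y x = 0

end Pluriharmonic

section Twistor

/-- The real smooth manifold underlying a complex manifold. -/
instance (priority := 50) isManifold_real_of_complex {F : Type*} [NormedAddCommGroup F]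
    [NormedSpace ℂ F] {Z : Type*} [TopologicalSpace Z] [ChartedSpace F Z]
    [IsManifold 𝓘(ℂ, F) ω Z] : IsManifold 𝓘(ℝ, F) ∞ Z := by
  refine isManifold_of_contDiffOn 𝓘(ℝ, F) ∞ Z fun e e' he he' ↦ ?_
  have h := (contDiffGroupoid ω 𝓘(ℂ, F)).compatible he he'
  rw [contDiffGroupoid, mem_groupoid_of_pregroupoid] at h
  exact (h.1.restrict_scalars ℝ).of_le le_top

variable (E : Type*) [NormedAddCommGroup E] [NormedSpace ℝ E] [FiniteDimensional ℝ E]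
  (N : Type*) [TopologicalSpace N] [ChartedSpace E N] [IsManifold 𝓘(ℝ, E) ∞ N]
  [RiemannianBundle (fun x : N ↦ TangentSpace 𝓘(ℝ, E) x)]

/-- The bundle `𝒥(N)` of almost Hermitian structures, as a subset of the total space of `End(TN)`:
its elements over `x` are the `j ∈ End(T_x N)` with `j² = -1` and `h(j ·, ·) = -h(·, j ·)`. -/
def almostHermitianBundle : Set (EndTangent E N) :=
  {a | (∀ v : TangentSpace 𝓘(ℝ, E) a.proj, a.snd (a.snd v) = -v) ∧
    ∀ v w : TangentSpace 𝓘(ℝ, E) a.proj, (inner ℝ (a.snd v) w : ℝ) = -inner ℝ v (a.snd w)}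

variable [IsContMDiffRiemannianBundle 𝓘(ℝ, E) ∞ E (fun x : N ↦ TangentSpace 𝓘(ℝ, E) x)]

variable {E N} in
/-- The vertical component of a tangent vector of `𝒥(N)` at `j`, with respect to the Levi-Civita
connection. The horizontal space `𝓗_j` is its kernel. On the vertical space `𝓥_j`, it is an
isomorphism onto the skew-symmetric endomorphisms `A` of the tangent space with `A j = - j A`; in
these terms the complex structure `J^𝓥` of the fibre is `A ↦ j A`. -/
def verticalPart (j : EndTangent E N)
    (ξ : TangentSpace (𝓘(ℝ, E).prod 𝓘(ℝ, E →L[ℝ] E)) j) :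
    TangentSpace 𝓘(ℝ, E) j.proj →L[ℝ] TangentSpace 𝓘(ℝ, E) j.proj :=
  connector (leviCivita E N) j ξ

/-- Multiplication by the imaginary unit on the tangent space of a complex manifold `Z`. -/
def complexMul {F : Type*} [NormedAddCommGroup F] [NormedSpace ℂ F] {Z : Type*}
    [TopologicalSpace Z] [ChartedSpace F Z] (z : Z) :
    TangentSpace 𝓘(ℝ, F) z →L[ℝ] TangentSpace 𝓘(ℝ, F) z :=
  (Complex.I • ContinuousLinearMap.id ℝ F : F →L[ℝ] F)

/-- A twistor space `p : Z → N` over the Riemannian manifold `N`. Here `Z` is a complex manifold,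
and `p` is the composition of the fibre preserving map `i : Z → 𝒥(N)` with the projection
`𝒥(N) → N`. -/
structure TwistorSpace (F : Type*) [NormedAddCommGroup F] [NormedSpace ℂ F]
    (Z : Type*) [TopologicalSpace Z] [ChartedSpace F Z] [IsManifold 𝓘(ℂ, F) ω Z] where
  /-- The map to `𝒥(N)`. -/
  i : Z → EndTangent E N
  i_mem : ∀ z, i z ∈ almostHermitianBundle E N
  i_smooth : ContMDiff 𝓘(ℝ, F) (𝓘(ℝ, E).prod 𝓘(ℝ, E →L[ℝ] E)) ∞ i
  /-- `p` is a submersion. -/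
  submersion : ∀ z, Function.Surjective (mfderiv 𝓘(ℝ, F) 𝓘(ℝ, E) (fun z ↦ (i z).proj) z)
  /-- The fibres of `p` are complex submanifolds. -/
  complex_fibers : ∀ (z : Z) (v : TangentSpace 𝓘(ℝ, F) z),
    mfderiv 𝓘(ℝ, F) 𝓘(ℝ, E) (fun z ↦ (i z).proj) z v = 0 →
      mfderiv 𝓘(ℝ, F) 𝓘(ℝ, E) (fun z ↦ (i z).proj) z (complexMul z v) = 0
  /-- The horizontal distribution. -/
  H : Π z : Z, Submodule ℝ (TangentSpace 𝓘(ℝ, F) z)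
  H_isCompl : ∀ z, IsCompl (H z)
    (LinearMap.ker (mfderiv 𝓘(ℝ, F) 𝓘(ℝ, E) (fun z ↦ (i z).proj) z).toLinearMap)
  H_smooth : ∀ (z : Z), ∀ v ∈ H z, ∃ X : Π z : Z, TangentSpace 𝓘(ℝ, F) z,
    ContMDiff 𝓘(ℝ, F) 𝓘(ℝ, F).tangent ∞ (fun z' ↦ (⟨z', X z'⟩ : TangentBundle 𝓘(ℝ, F) Z)) ∧
      X z = v ∧ ∀ z', X z' ∈ H z'
  /-- `i` maps the horizontal distribution of `Z` to the one of `𝒥(N)`. -/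
  i_horizontal : ∀ (z : Z), ∀ v ∈ H z,
    verticalPart (i z) (mfderiv 𝓘(ℝ, F) (𝓘(ℝ, E).prod 𝓘(ℝ, E →L[ℝ] E)) i z v) = 0
  /-- `i` is holomorphic between the fibres: `di(√-1 v) = J^𝓥 di(v)` for vertical `v`. -/
  i_holomorphic : ∀ (z : Z) (v : TangentSpace 𝓘(ℝ, F) z),
    mfderiv 𝓘(ℝ, F) 𝓘(ℝ, E) (fun z ↦ (i z).proj) z v = 0 →
      verticalPart (i z)
          (mfderiv 𝓘(ℝ, F) (𝓘(ℝ, E).prod 𝓘(ℝ, E →L[ℝ] E)) i z (complexMul z v)) =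
        (i z).snd ∘L
          verticalPart (i z) (mfderiv 𝓘(ℝ, F) (𝓘(ℝ, E).prod 𝓘(ℝ, E →L[ℝ] E)) i z v)

namespace TwistorSpace

variable {E N} {F : Type*} [NormedAddCommGroup F] [NormedSpace ℂ F]
  {Z : Type*} [TopologicalSpace Z] [ChartedSpace F Z] [IsManifold 𝓘(ℂ, F) ω Z]
  (T : TwistorSpace E N F Z)

/-- The projection `p : Z → N`. -/
def p (z : Z) : N := (T.i z).proj

/-- The differential of `p` at `z`. -/
def dp (z : Z) : TangentSpace 𝓘(ℝ, F) z →L[ℝ] TangentSpace 𝓘(ℝ, E) (T.p z) :=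
  mfderiv 𝓘(ℝ, F) 𝓘(ℝ, E) T.p z

/-- The differential of `p` restricts to an isomorphism from the horizontal space at `z` onto the
tangent space of `N` at `p z`. -/
def horizontalEquiv (z : Z) : T.H z ≃ₗ[ℝ] TangentSpace 𝓘(ℝ, E) (T.p z) :=
  LinearEquiv.ofBijective ((T.dp z).toLinearMap ∘ₗ (T.H z).subtype) (by
    constructor
    · rw [← LinearMap.ker_eq_bot, LinearMap.ker_comp, ← Submodule.disjoint_iff_comap_eq_bot]
      exact (T.H_isCompl z).disjoint
    · intro w
      obtain ⟨v, hv⟩ := T.submersion z w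
      obtain ⟨a, ha, b, hb, rfl⟩ := Submodule.mem_sup.1
        ((T.H_isCompl z).sup_eq_top ▸ Submodule.mem_top : v ∈ _ ⊔ _)
      refine ⟨⟨a, ha⟩, ?_⟩
      rw [← hv, map_add]
      exact (add_zero _).symm.trans (congrArg (fun t ↦ _ + t) hb.symm))

/-- The horizontal lift of a tangent vector of `N` to the point `z`. -/
def lift (z : Z) : TangentSpace 𝓘(ℝ, E) (T.p z) →ₗ[ℝ] TangentSpace 𝓘(ℝ, F) z :=
  (T.H z).subtype ∘ₗ (T.horizontalEquiv z).symm.toLinearMap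

/-- The almost complex structure `J₂ = (-J^𝓥) + J^𝓗` of the twistor space. For the decomposition
`v = v^𝓗 + v^𝓥` with `v^𝓗 = lift (dp v)`, the vertical part is multiplied by `-√-1`, and `J^𝓗 v^𝓗`
is the horizontal lift of `j (dp v)`, where `j = i z`. -/
def J₂ (z : Z) (v : TangentSpace 𝓘(ℝ, F) z) : TangentSpace 𝓘(ℝ, F) z :=
  -(complexMul z (v - T.lift z (T.dp z v))) + T.lift z ((T.i z).snd (T.dp z v))

/-- The (smooth) map `ψ : (M, J) → (Z, J₂)` is holomorphic: `dψ ∘ J = J₂ ∘ dψ`. -/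
structure IsJ₂Holomorphic {EM : Type*} [NormedAddCommGroup EM] [NormedSpace ℝ EM]
    {M : Type*} [TopologicalSpace M] [ChartedSpace EM M] [IsManifold 𝓘(ℝ, EM) ∞ M]
    (J : AlmostComplexStructure EM M) (ψ : M → Z) : Prop where
  smooth : ContMDiff 𝓘(ℝ, EM) 𝓘(ℝ, F) ∞ ψ
  holomorphic : ∀ (x : M) (v : TangentSpace 𝓘(ℝ, EM) x),
    mfderiv 𝓘(ℝ, EM) 𝓘(ℝ, F) ψ x (J.J x v) = T.J₂ (ψ x) (mfderiv 𝓘(ℝ, EM) 𝓘(ℝ, F) ψ x v)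

end TwistorSpace

end Twistor

end TwistorGeom

end

open TwistorGeom

/-! Write φ = p ∘ ψ, let j = i ∘ ψ be the almost complex structure along φ, and B = ∇dφ. The
horizontal half of J₂-holomorphicity says dφ(JX) = j dφ(X) (`dp_J₂`). The vertical half says ∇_{JX}
j = -j ∇_X j (`verticalDeriv_J₂`); the sign is that of J₂ on the fibres.

Since DJ = 0, differentiating the first identity with `pullbackDeriv_clm_apply` gives B(X, JY) =
(∇_X j) dφ(Y) + j B(X, Y). Replacing X by JX and eliminating ∇j with the second identity yields B(X,
Y) + B(JX, JY) = j (B(JX, Y) - B(X, JY)).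

By `pullbackDeriv_mfderiv_sub`, B(X, Y) - B(Y, X) = -dφ(T(X, Y)), with T the torsion of D. As
T^{1,1} = 0, we have T(JX, JY) = -T(X, Y) and T(JX, Y) = T(X, JY). Hence the left side above is
symmetric in X, Y and the right side antisymmetric, so both vanish. This argument is
`secondFundamentalForm_oneOnePart_eq_zero`; most of the remaining work is computing pull-back
connections in charts. -/

noncomputable section

namespace TwistorGeom

/-! ### Lie brackets as commutators of derivations on vector-valued functions. -/

section Bracket

variable {E : Type*} [NormedAddCommGroup E] [NormedSpace ℝ E] [CompleteSpace E]
  {M : Type*} [TopologicalSpace M] [ChartedSpace E M] [IsManifold 𝓘(ℝ, E) ∞ M]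
  {F : Type*} [NormedAddCommGroup F] [NormedSpace ℝ F]

/-- A vector field read in the preferred chart at `x`. -/
def inChart (x : M) (Y : Π x : M, TangentSpace 𝓘(ℝ, E) x) : E → E :=
  VectorField.mpullbackWithin 𝓘(ℝ, E) 𝓘(ℝ, E) (extChartAt 𝓘(ℝ, E) x).symm Y Set.univ

/-- The pull-back along the inverse chart applies the inverse of its derivative, and that inverse is
the derivative of the chart. -/
theorem inChart_eq {x y : M} (hy : y ∈ (extChartAt 𝓘(ℝ, E) x).source)
    (Y : Π x : M, TangentSpace 𝓘(ℝ, E) x) :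
    inChart x Y (extChartAt 𝓘(ℝ, E) x y) =
      mfderiv 𝓘(ℝ, E) 𝓘(ℝ, E) (extChartAt 𝓘(ℝ, E) x) y (Y y) := by
  have h := ContinuousLinearMap.inverse_eq
    (mfderivWithin_extChartAt_symm_comp_mfderiv_extChartAt' (I := 𝓘(ℝ, E)) hy)
    (mfderiv_extChartAt_comp_mfderivWithin_extChartAt_symm' (I := 𝓘(ℝ, E)) hy)
  rw [modelWithCornersSelf_coe, Set.range_id] at h
  rw [inChart, VectorField.mpullbackWithin_apply, (extChartAt 𝓘(ℝ, E) x).left_inv hy]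
  exact congr($h (Y y))

theorem inChart_self (x : M) (Y : Π x : M, TangentSpace 𝓘(ℝ, E) x) :
    inChart x Y (extChartAt 𝓘(ℝ, E) x x) = Y x := by
  rw [inChart_eq (mem_extChartAt_source x), mfderiv_extChartAt_self]
  rfl

theorem differentiableAt_inChart {x : M} {Y : Π x : M, TangentSpace 𝓘(ℝ, E) x}
    (hY : MDiffAt (T% Y) x) : DifferentiableAt ℝ (inChart x Y) (extChartAt 𝓘(ℝ, E) x x) := by
  have h := MDifferentiableWithinAt.differentiableWithinAt_mpullbackWithin_vectorField
    hY.mdifferentiableWithinAt (s := Set.univ)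
  rw [modelWithCornersSelf_coe, Set.range_id, Set.preimage_univ, Set.inter_univ] at h
  exact differentiableWithinAt_univ.1 h

/-- The manifold bracket is the chart bracket transported back by the derivative of the chart, which
at its own base point is the identity. -/
theorem mlieBracket_eq_inChart (x : M) (X Y : Π x : M, TangentSpace 𝓘(ℝ, E) x) :
    VectorField.mlieBracket 𝓘(ℝ, E) X Y x =
      VectorField.lieBracket ℝ (inChart x X) (inChart x Y) (extChartAt 𝓘(ℝ, E) x x) := by
  rw [← VectorField.mlieBracketWithin_univ, VectorField.mlieBracketWithin_apply,
    modelWithCornersSelf_coe, Set.range_id, Set.preimage_univ, Set.inter_univ,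
    mfderiv_extChartAt_self]
  have h : VectorField.lieBracketWithin ℝ (inChart x X) (inChart x Y) Set.univ =
      VectorField.lieBracket ℝ (inChart x X) (inChart x Y) := VectorField.lieBracketWithin_univ
  exact (congrArg (fun A : E →L[ℝ] E ↦ A (VectorField.lieBracketWithin ℝ (inChart x X)
    (inChart x Y) Set.univ (extChartAt 𝓘(ℝ, E) x x))) ContinuousLinearMap.inverse_id).trans
      congr($h _)

/-- The chain rule through the chart at `x`. It is needed at every `y` in the chart domain, because
the result gets differentiated once more at `x`. -/
theorem mvfderiv_eq_fderiv {x y : M} (hy : y ∈ (extChartAt 𝓘(ℝ, E) x).source)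
    {g : M → F} (hg : MDifferentiableAt 𝓘(ℝ, E) 𝓘(ℝ, F) g y)
    (v : TangentSpace 𝓘(ℝ, E) y) :
    mvfderiv 𝓘(ℝ, E) g y v =
      fderiv ℝ (g ∘ (extChartAt 𝓘(ℝ, E) x).symm) (extChartAt 𝓘(ℝ, E) x y)
        (mfderiv 𝓘(ℝ, E) 𝓘(ℝ, E) (extChartAt 𝓘(ℝ, E) x) y v) := by
  have hi := (extChartAt 𝓘(ℝ, E) x).left_inv hy
  have hs : MDifferentiableAt 𝓘(ℝ, E) 𝓘(ℝ, E) (extChartAt 𝓘(ℝ, E) x).symm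
      (extChartAt 𝓘(ℝ, E) x y) := by
    have := mdifferentiableWithinAt_extChartAt_symm (I := 𝓘(ℝ, E)) (x := x)
      ((extChartAt 𝓘(ℝ, E) x).map_source hy)
    simpa [mdifferentiableWithinAt_univ] using this
  have h1 : HasMFDerivAt 𝓘(ℝ, E) 𝓘(ℝ, F) g
      ((extChartAt 𝓘(ℝ, E) x).symm (extChartAt 𝓘(ℝ, E) x y)) (mvfderiv 𝓘(ℝ, E) g y : E →L[ℝ] F) := by
    rw [hi]; exact hg.hasMFDerivAt
  have h2 : HasFDerivAt (g ∘ (extChartAt 𝓘(ℝ, E) x).symm)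
      ((mvfderiv 𝓘(ℝ, E) g y : E →L[ℝ] F) ∘L (mfderiv 𝓘(ℝ, E) 𝓘(ℝ, E)
        (extChartAt 𝓘(ℝ, E) x).symm (extChartAt 𝓘(ℝ, E) x y) : E →L[ℝ] E))
      (extChartAt 𝓘(ℝ, E) x y) := (h1.comp _ hs.hasMFDerivAt).hasFDerivAt
  have h3 := mfderivWithin_extChartAt_symm_comp_mfderiv_extChartAt' (I := 𝓘(ℝ, E)) hy
  rw [modelWithCornersSelf_coe, Set.range_id, mfderivWithin_univ] at h3
  exact (congrArg (mvfderiv 𝓘(ℝ, E) g y) congr($h3 v).symm).trans congr($(h2.fderiv.symm) _)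

theorem contDiffAt_inChart {x : M} {g : M → F}
    (hg : ContMDiffAt 𝓘(ℝ, E) 𝓘(ℝ, F) 2 g x) :
    ContDiffAt ℝ 2 (g ∘ (extChartAt 𝓘(ℝ, E) x).symm) (extChartAt 𝓘(ℝ, E) x x) := by
  have h := (contMDiffAt_iff.1 hg).2
  rw [modelWithCornersSelf_coe, Set.range_id] at h
  exact contDiffWithinAt_univ.1 h

/-- The derivative of `Y g` along `v`, in the preferred chart at `x`. -/
theorem hasMFDerivAt_mvfderiv_apply {x : M} {g : M → F}
    (hg : ContMDiffAt 𝓘(ℝ, E) 𝓘(ℝ, F) 2 g x)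
    {Y : Π x : M, TangentSpace 𝓘(ℝ, E) x} (hY : MDiffAt (T% Y) x) :
    HasMFDerivAt 𝓘(ℝ, E) 𝓘(ℝ, F) (fun y ↦ mvfderiv 𝓘(ℝ, E) g y (Y y)) x
      (fderiv ℝ (fun z ↦ fderiv ℝ (g ∘ (extChartAt 𝓘(ℝ, E) x).symm) z (inChart x Y z))
        (extChartAt 𝓘(ℝ, E) x x) : E →L[ℝ] F) := by
  have h1 : DifferentiableAt ℝ
      (fun z ↦ fderiv ℝ (g ∘ (extChartAt 𝓘(ℝ, E) x).symm) z (inChart x Y z))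
      (extChartAt 𝓘(ℝ, E) x x) :=
    (((contDiffAt_inChart hg).fderiv_right (m := 1) le_rfl).differentiableAt one_ne_zero).clm_apply
      (differentiableAt_inChart hY)
  have h2 := h1.hasFDerivAt.hasMFDerivAt.comp x
    (mdifferentiableAt_extChartAt (I := 𝓘(ℝ, E)) (mem_chart_source E x)).hasMFDerivAt
  rw [mfderiv_extChartAt_self] at h2
  refine h2.congr_of_eventuallyEq ?_
  filter_upwards [extChartAt_source_mem_nhds (I := 𝓘(ℝ, E)) x,
    (contMDiffAt_iff_contMDiffAt_nhds (by decide)).1 hg] with y hy hgy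
  rw [mvfderiv_eq_fderiv hy (hgy.mdifferentiableAt (by decide))]
  simp only [Function.comp_apply, inChart_eq hy]

/-- `X (Y g) - Y (X g) = [X, Y] g`. -/
theorem mvfderiv_mlieBracket {x : M} {g : M → F} (hg : ContMDiffAt 𝓘(ℝ, E) 𝓘(ℝ, F) 2 g x)
    {X Y : Π x : M, TangentSpace 𝓘(ℝ, E) x} (hX : MDiffAt (T% X) x) (hY : MDiffAt (T% Y) x) :
    mvfderiv 𝓘(ℝ, E) (fun y ↦ mvfderiv 𝓘(ℝ, E) g y (Y y)) x (X x)
      - mvfderiv 𝓘(ℝ, E) (fun y ↦ mvfderiv 𝓘(ℝ, E) g y (X y)) x (Y x) =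
      mvfderiv 𝓘(ℝ, E) g x (VectorField.mlieBracket 𝓘(ℝ, E) X Y x) := by
  have hc := contDiffAt_inChart hg
  have hd := (hc.fderiv_right (m := 1) le_rfl).differentiableAt one_ne_zero
  -- This symmetry cancels the second-order terms of the commutator.
  have hs := hc.isSymmSndFDerivAt (by simp)
  -- Product rule in the chart: V(Y g) = Dg(DY · V) + D²g(V, Y).
  have key : ∀ {Y V : Π x : M, TangentSpace 𝓘(ℝ, E) x}, MDiffAt (T% Y) x →
      mvfderiv 𝓘(ℝ, E) (fun y ↦ mvfderiv 𝓘(ℝ, E) g y (Y y)) x (V x) =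
        fderiv ℝ (g ∘ (extChartAt 𝓘(ℝ, E) x).symm) (extChartAt 𝓘(ℝ, E) x x)
          (fderiv ℝ (inChart x Y) (extChartAt 𝓘(ℝ, E) x x) (V x)) +
        fderiv ℝ (fderiv ℝ (g ∘ (extChartAt 𝓘(ℝ, E) x).symm)) (extChartAt 𝓘(ℝ, E) x x) (V x)
          (Y x) := by
    intro Y V hY
    have h1 := congr($((hasMFDerivAt_mvfderiv_apply hg hY).mfderiv) (V x))
    rw [fderiv_clm_apply hd (differentiableAt_inChart hY), inChart_self] at h1
    exact h1
  rw [key hX, key hY, hs (X x) (Y x), mvfderiv_eq_fderiv (mem_extChartAt_source x)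
    (hg.mdifferentiableAt (by decide)), mfderiv_extChartAt_self, mlieBracket_eq_inChart,
    VectorField.lieBracket_eq]
  simp only [inChart_self]
  rw [add_sub_add_right_eq_sub, ← map_sub]
  rfl

end Bracket

/-! ### The pull-back connection applied to the differential of a map. -/

section Pullback

variable {EM : Type*} [NormedAddCommGroup EM] [NormedSpace ℝ EM] [FiniteDimensional ℝ EM]
  {M : Type*} [TopologicalSpace M] [ChartedSpace EM M] [IsManifold 𝓘(ℝ, EM) ∞ M]
  {E : Type*} [NormedAddCommGroup E] [NormedSpace ℝ E] [FiniteDimensional ℝ E]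
  {N : Type*} [TopologicalSpace N] [ChartedSpace E N] [IsManifold 𝓘(ℝ, E) ∞ N]

/-- The frame used to define `pullbackDeriv` is thus the coordinate frame of the chart at `x`, so
components of vectors are derivatives of coordinates. -/
theorem trivializationAt_snd_eq_mfderiv {x y : N} (hy : y ∈ (chartAt E x).source)
    (v : TangentSpace 𝓘(ℝ, E) y) :
    (trivializationAt E (TangentSpace 𝓘(ℝ, E) : N → Type _) x ⟨y, v⟩).2 =
      mfderiv 𝓘(ℝ, E) 𝓘(ℝ, E) (extChartAt 𝓘(ℝ, E) x) y v := by
  have h := congr($(TangentBundle.continuousLinearMapAt_trivializationAt (I := 𝓘(ℝ, E)) hy) v)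
  rw [← h]
  exact (Trivialization.continuousLinearMapAt_apply_of_mem _ _ hy v).symm

theorem symmL_trivializationAt_apply {x : N} (v : TangentSpace 𝓘(ℝ, E) x) :
    (trivializationAt E (TangentSpace 𝓘(ℝ, E) : N → Type _) x).symmL ℝ x
      (trivializationAt E (TangentSpace 𝓘(ℝ, E) : N → Type _) x ⟨x, v⟩).2 = v := by
  have hb := FiberBundle.mem_baseSet_trivializationAt' (F := E)
    (E := (TangentSpace 𝓘(ℝ, E) : N → Type _)) x
  rw [Trivialization.symmL_apply _ hb]
  exact Trivialization.symm_apply_apply_mk _ hb _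

/-- `extend` keeps the coefficients constant in the preferred frame, which is the coordinate frame.
-/
theorem inChart_extend_eventuallyEq {x : N} (w : TangentSpace 𝓘(ℝ, E) x) :
    inChart x (extend E w) =ᶠ[nhds (extChartAt 𝓘(ℝ, E) x x)] fun _ ↦ (w : E) := by
  filter_upwards [extChartAt_target_mem_nhds (I := 𝓘(ℝ, E)) x] with z hz
  have hy := (extChartAt 𝓘(ℝ, E) x).map_target hz
  have hy' : (extChartAt 𝓘(ℝ, E) x).symm z ∈ (chartAt E x).source := by
    rwa [extChartAt_source] at hy
  have h := inChart_eq hy (extend E w)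
  rw [(extChartAt 𝓘(ℝ, E) x).right_inv hz] at h
  have h1 := trivializationAt_snd_eq_mfderiv hy' (extend E w _)
  have h2 := trivializationAt_snd_eq_mfderiv (mem_chart_source E x) w
  rw [mfderiv_extChartAt_self] at h2
  refine h.trans (h1.symm.trans (Eq.trans ?_ h2))
  have h3 := congrArg Prod.snd
    ((trivializationAt E (TangentSpace 𝓘(ℝ, E) : N → Type _) x).apply_mk_symm hy'
      (trivializationAt E (TangentSpace 𝓘(ℝ, E) : N → Type _) x ⟨x, w⟩).2)
  exact h3

/-- Fields with constant coefficients in a coordinate frame commute. -/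
theorem mlieBracket_extend {x : N} (v w : TangentSpace 𝓘(ℝ, E) x) :
    VectorField.mlieBracket 𝓘(ℝ, E) (extend E v) (extend E w) x = 0 := by
  rw [mlieBracket_eq_inChart, VectorField.lieBracket_eq]
  have h : ∀ w : TangentSpace 𝓘(ℝ, E) x,
      fderiv ℝ (inChart x (extend E w)) (extChartAt 𝓘(ℝ, E) x x) = 0 := fun w ↦
    (inChart_extend_eventuallyEq w).fderiv_eq.trans (fderiv_const_apply (w : E))
  simp only [h, zero_apply, sub_zero]
  rfl

/-- The symmetry of the Christoffel symbols of a torsion-free connection. -/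
theorem cov_extend_symm {cov : CovariantDerivative 𝓘(ℝ, E) E (TangentSpace 𝓘(ℝ, E) : N → Type _)}
    (hcov : cov.torsion = 0) {x : N} (v w : TangentSpace 𝓘(ℝ, E) x) :
    cov (extend E w) x v = cov (extend E v) x w := by
  have h := (cov.torsion_eq_zero_iff.1 hcov) (mdifferentiableAt_extend (σ₀ := v) ..)
    (mdifferentiableAt_extend (σ₀ := w) ..)
  rw [mlieBracket_extend, extend_apply_self, extend_apply_self] at h
  exact sub_eq_zero.1 h

/-- The chain rule for the coordinates of `N` composed with `f`. Equality near `m`, not only at `m`,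
allows both sides to be differentiated. -/
theorem mfderiv_apply_snd_eventuallyEq {f : M → N} {m : M}
    (hf : ContMDiffAt 𝓘(ℝ, EM) 𝓘(ℝ, E) 2 f m) (Y : Π m : M, TangentSpace 𝓘(ℝ, EM) m) :
    (fun m' ↦ (trivializationAt E (TangentSpace 𝓘(ℝ, E) : N → Type _) (f m)
      ⟨f m', mfderiv 𝓘(ℝ, EM) 𝓘(ℝ, E) f m' (Y m')⟩).2) =ᶠ[nhds m]
      fun m' ↦ mvfderiv 𝓘(ℝ, EM) (extChartAt 𝓘(ℝ, E) (f m) ∘ f) m' (Y m') := by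
  filter_upwards [hf.continuousAt.preimage_mem_nhds ((chartAt E (f m)).open_source.mem_nhds
    (mem_chart_source E (f m))), (contMDiffAt_iff_contMDiffAt_nhds (by decide)).1 hf] with y hy hfy
  rw [trivializationAt_snd_eq_mfderiv hy]
  have h := mfderiv_comp y (mdifferentiableAt_extChartAt (I := 𝓘(ℝ, E)) hy)
    (hfy.mdifferentiableAt (by decide))
  exact congr($h (Y y)).symm

theorem contMDiffAt_extChartAt_comp {f : M → N} {m : M}
    (hf : ContMDiffAt 𝓘(ℝ, EM) 𝓘(ℝ, E) 2 f m) :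
    ContMDiffAt 𝓘(ℝ, EM) 𝓘(ℝ, E) 2 (extChartAt 𝓘(ℝ, E) (f m) ∘ f) m :=
  ContMDiffAt.comp m (contMDiffAt_extChartAt (n := 2)) hf

/-- Provides the differentiability that the Leibniz rule `pullbackDeriv_clm_apply` asks of the
section df(Y). -/
theorem mdifferentiableAt_mfderiv_apply_snd {f : M → N} {m : M}
    (hf : ContMDiffAt 𝓘(ℝ, EM) 𝓘(ℝ, E) 2 f m) {Y : Π m : M, TangentSpace 𝓘(ℝ, EM) m}
    (hY : MDiffAt (T% Y) m) :
    MDifferentiableAt 𝓘(ℝ, EM) 𝓘(ℝ, E)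
      (fun m' ↦ (trivializationAt E (TangentSpace 𝓘(ℝ, E) : N → Type _) (f m)
        ⟨f m', mfderiv 𝓘(ℝ, EM) 𝓘(ℝ, E) f m' (Y m')⟩).2) m :=
  ((hasMFDerivAt_mvfderiv_apply (contMDiffAt_extChartAt_comp hf) hY).mdifferentiableAt
    ).congr_of_eventuallyEq (mfderiv_apply_snd_eventuallyEq hf Y)

/-- The pull-back of a torsion-free connection: `∇_X (df Y) - ∇_Y (df X) = df [X, Y]`. -/
theorem pullbackDeriv_mfderiv_sub
    {cov : CovariantDerivative 𝓘(ℝ, E) E (TangentSpace 𝓘(ℝ, E) : N → Type _)}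
    (hcov : cov.torsion = 0) {f : M → N} {m : M}
    (hf : ContMDiffAt 𝓘(ℝ, EM) 𝓘(ℝ, E) 2 f m) {X Y : Π m : M, TangentSpace 𝓘(ℝ, EM) m}
    (hX : MDiffAt (T% X) m) (hY : MDiffAt (T% Y) m) :
    pullbackDeriv cov f (fun m' ↦ mfderiv 𝓘(ℝ, EM) 𝓘(ℝ, E) f m' (Y m')) m (X m)
      - pullbackDeriv cov f (fun m' ↦ mfderiv 𝓘(ℝ, EM) 𝓘(ℝ, E) f m' (X m')) m (Y m) =
      mfderiv 𝓘(ℝ, EM) 𝓘(ℝ, E) f m (VectorField.mlieBracket 𝓘(ℝ, EM) X Y m) := by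
  let e := trivializationAt E (TangentSpace 𝓘(ℝ, E) : N → Type _) (f m)
  -- Splits the derivative into a second derivative of the coordinates of `f` and a Christoffel term
  -- Γ(df V, df Y).
  have key : ∀ {Y V : Π m : M, TangentSpace 𝓘(ℝ, EM) m},
      pullbackDeriv cov f (fun m' ↦ mfderiv 𝓘(ℝ, EM) 𝓘(ℝ, E) f m' (Y m')) m (V m) =
        e.symmL ℝ (f m) (mvfderiv 𝓘(ℝ, EM)
          (fun m' ↦ mvfderiv 𝓘(ℝ, EM) (extChartAt 𝓘(ℝ, E) (f m) ∘ f) m' (Y m')) m (V m)) +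
        cov (extend E (mfderiv 𝓘(ℝ, EM) 𝓘(ℝ, E) f m (Y m))) (f m)
          (mfderiv 𝓘(ℝ, EM) 𝓘(ℝ, E) f m (V m)) := by
    intro Y V
    have h := congr($((mfderiv_apply_snd_eventuallyEq hf Y).mfderiv_eq
      (I := 𝓘(ℝ, EM)) (I' := 𝓘(ℝ, E))) (V m))
    exact congrArg (fun t : E ↦ e.symmL ℝ (f m) t + cov (extend E
      (mfderiv 𝓘(ℝ, EM) 𝓘(ℝ, E) f m (Y m))) (f m) (mfderiv 𝓘(ℝ, EM) 𝓘(ℝ, E) f m (V m))) h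
  -- The Christoffel terms cancel by symmetry; what remains is the commutator of X and Y on the
  -- coordinates of `f`.
  rw [key, key, cov_extend_symm hcov, add_sub_add_right_eq_sub, ← map_sub,
    mvfderiv_mlieBracket (contMDiffAt_extChartAt_comp hf) hX hY]
  have h := (mfderiv_apply_snd_eventuallyEq hf (VectorField.mlieBracket 𝓘(ℝ, EM) X Y)).self_of_nhds
  exact (congrArg (e.symmL ℝ (f m)) h.symm).trans (symmL_trivializationAt_apply _)

/-! ### Endomorphism fields along a map and the Leibniz rule. -/

theorem trivializationAt_hom_apply {x y : N} (hy : y ∈ (chartAt E x).source)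
    (A : TangentSpace 𝓘(ℝ, E) y →L[ℝ] TangentSpace 𝓘(ℝ, E) y) (v : TangentSpace 𝓘(ℝ, E) y) :
    (trivializationAt (E →L[ℝ] E)
        (fun x : N ↦ TangentSpace 𝓘(ℝ, E) x →L[ℝ] TangentSpace 𝓘(ℝ, E) x) x ⟨y, A⟩).2
      (trivializationAt E (TangentSpace 𝓘(ℝ, E) : N → Type _) x ⟨y, v⟩).2 =
    (trivializationAt E (TangentSpace 𝓘(ℝ, E) : N → Type _) x ⟨y, A v⟩).2 := by
  let e := trivializationAt E (TangentSpace 𝓘(ℝ, E) : N → Type _) x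
  have hb : y ∈ e.baseSet := hy
  have h1 : ∀ w : TangentSpace 𝓘(ℝ, E) y, (e ⟨y, w⟩).2 = e.continuousLinearMapAt ℝ y w :=
    fun w ↦ (Trivialization.continuousLinearMapAt_apply_of_mem _ _ hb w).symm
  change e.continuousLinearMapAt ℝ y (A (e.symmL ℝ y (e ⟨y, v⟩).2)) = (e ⟨y, A v⟩).2
  rw [h1, h1, e.symmL_continuousLinearMapAt hb]

/-- The trivialization of End(TN) is conjugation by that of TN. This evaluates the A' term of
`connector` on a vector. -/
theorem symmL_trivializationAt_hom_apply {x : N} (B : E →L[ℝ] E) (v : TangentSpace 𝓘(ℝ, E) x) :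
    (trivializationAt (E →L[ℝ] E)
        (fun x : N ↦ TangentSpace 𝓘(ℝ, E) x →L[ℝ] TangentSpace 𝓘(ℝ, E) x) x).symmL ℝ x B v =
      (trivializationAt E (TangentSpace 𝓘(ℝ, E) : N → Type _) x).symmL ℝ x
        (B (trivializationAt E (TangentSpace 𝓘(ℝ, E) : N → Type _) x ⟨x, v⟩).2) := by
  let e' := trivializationAt (E →L[ℝ] E)
    (fun x : N ↦ TangentSpace 𝓘(ℝ, E) x →L[ℝ] TangentSpace 𝓘(ℝ, E) x) x
  have hb : x ∈ e'.baseSet := FiberBundle.mem_baseSet_trivializationAt' x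
  have h := trivializationAt_hom_apply (mem_chart_source E x) (e'.symmL ℝ x B) v
  have h2 : (e' ⟨x, e'.symmL ℝ x B⟩).2 = B := by
    rw [e'.symmL_apply hb, e'.apply_mk_symm hb]
  rw [h2] at h
  rw [h, symmL_trivializationAt_apply]

/-- The chain rule through the bounded bilinear evaluation map. -/
theorem mvfderiv_clm_apply {F G : Type*} [NormedAddCommGroup F] [NormedSpace ℝ F]
    [NormedAddCommGroup G] [NormedSpace ℝ G] {m : M} {A : M → F →L[ℝ] G} {s : M → F}
    (hA : MDifferentiableAt 𝓘(ℝ, EM) 𝓘(ℝ, F →L[ℝ] G) A m)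
    (hs : MDifferentiableAt 𝓘(ℝ, EM) 𝓘(ℝ, F) s m) (v : TangentSpace 𝓘(ℝ, EM) m) :
    mvfderiv 𝓘(ℝ, EM) (fun m ↦ A m (s m)) m v =
      mvfderiv 𝓘(ℝ, EM) A m v (s m) + A m (mvfderiv 𝓘(ℝ, EM) s m v) := by
  have h1 : HasMFDerivAt 𝓘(ℝ, EM) 𝓘(ℝ, (F →L[ℝ] G) × F) (fun m ↦ (A m, s m)) m
      ((mvfderiv 𝓘(ℝ, EM) A m).prod (mvfderiv 𝓘(ℝ, EM) s m) : EM →L[ℝ] (F →L[ℝ] G) × F) :=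
    ⟨hA.continuousAt.prodMk hs.continuousAt, hA.hasMFDerivAt.2.prodMk hs.hasMFDerivAt.2⟩
  have h2 : HasMFDerivAt 𝓘(ℝ, (F →L[ℝ] G) × F) 𝓘(ℝ, G)
      (fun p : (F →L[ℝ] G) × F ↦ p.1 p.2) (A m, s m) _ :=
    (isBoundedBilinearMap_apply.hasFDerivAt (𝕜 := ℝ) (A m, s m)).hasMFDerivAt
  have h := HasMFDerivAt.comp m h2 h1
  refine congr($(h.mfderiv) v).trans ?_
  exact add_comm _ _

/-- The Leibniz rule `∇_v (A s) = (∇_v A) s + A ∇_v s` for a section `A` of `End(TN)` along a map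
and a section `s` of `TN` along the same map. -/
theorem pullbackDeriv_clm_apply
    (cov : CovariantDerivative 𝓘(ℝ, E) E (TangentSpace 𝓘(ℝ, E) : N → Type _))
    {A : M → EndTangent E N} {m : M}
    (hA : MDifferentiableAt 𝓘(ℝ, EM) (𝓘(ℝ, E).prod 𝓘(ℝ, E →L[ℝ] E)) A m)
    {s : Π m : M, TangentSpace 𝓘(ℝ, E) (A m).proj}
    (hs : MDifferentiableAt 𝓘(ℝ, EM) 𝓘(ℝ, E) (fun m' ↦ (trivializationAt E
      (TangentSpace 𝓘(ℝ, E) : N → Type _) (A m).proj ⟨(A m').proj, s m'⟩).2) m)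
    (v : TangentSpace 𝓘(ℝ, EM) m) :
    pullbackDeriv cov (fun m ↦ (A m).proj) (fun m ↦ (A m).snd (s m)) m v =
      connector cov (A m)
        (mfderiv 𝓘(ℝ, EM) (𝓘(ℝ, E).prod 𝓘(ℝ, E →L[ℝ] E)) A m v) (s m) +
      (A m).snd (pullbackDeriv cov (fun m ↦ (A m).proj) s m v) := by
  let x := (A m).proj
  let e := trivializationAt E (TangentSpace 𝓘(ℝ, E) : N → Type _) x
  let e' := trivializationAt (E →L[ℝ] E)
    (fun x : N ↦ TangentSpace 𝓘(ℝ, E) x →L[ℝ] TangentSpace 𝓘(ℝ, E) x) x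
  have hp := mdifferentiableAt_proj (IB := 𝓘(ℝ, E)) (F := E →L[ℝ] E)
    (E := fun x : N ↦ TangentSpace 𝓘(ℝ, E) x →L[ℝ] TangentSpace 𝓘(ℝ, E) x) (p := A m)
  have hf := mfderiv_comp m hp hA
  have he' : MDifferentiableAt (𝓘(ℝ, E).prod 𝓘(ℝ, E →L[ℝ] E)) 𝓘(ℝ, E →L[ℝ] E)
      (fun b : EndTangent E N ↦ (e' b).2) (A m) :=
    ((mdifferentiableAt_totalSpace 𝓘(ℝ, E) (IM := 𝓘(ℝ, E).prod 𝓘(ℝ, E →L[ℝ] E))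
      (fun b : EndTangent E N ↦ b) (x₀ := A m)).1 mdifferentiableAt_id).2
  have hA' : MDifferentiableAt 𝓘(ℝ, EM) 𝓘(ℝ, E →L[ℝ] E) (fun m' ↦ (e' (A m')).2) m :=
    he'.comp m hA
  have hA2 := mfderiv_comp m he' hA
  -- In the frame, A s is a matrix times a column; this holds as long as the base point stays in the
  -- chart domain.
  have hev : (fun m' ↦ (e ⟨(A m').proj, (A m').snd (s m')⟩).2) =ᶠ[nhds m]
      fun m' ↦ (e' (A m')).2 (e ⟨(A m').proj, s m'⟩).2 := by
    have hc : ContinuousAt (fun m' ↦ (A m').proj) m := (hp.comp m hA).continuousAt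
    filter_upwards [hc.preimage_mem_nhds ((chartAt E x).open_source.mem_nhds
      (mem_chart_source E x))] with y hy
    exact (trivializationAt_hom_apply hy _ _).symm
  have h1 := congr($(hev.mfderiv_eq (I := 𝓘(ℝ, EM)) (I' := 𝓘(ℝ, E))) v)
  have h2 := mvfderiv_clm_apply hA' hs v
  have h3 : mvfderiv 𝓘(ℝ, EM) (fun m' ↦ (e' (A m')).2) m v =
      mvfderiv (𝓘(ℝ, E).prod 𝓘(ℝ, E →L[ℝ] E)) (fun b : EndTangent E N ↦ (e' b).2) (A m)
        (mfderiv 𝓘(ℝ, EM) (𝓘(ℝ, E).prod 𝓘(ℝ, E →L[ℝ] E)) A m v) := congr($hA2 v)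
  have h4 : mfderiv 𝓘(ℝ, EM) 𝓘(ℝ, E) (fun m ↦ (A m).proj) m v =
      mfderiv (𝓘(ℝ, E).prod 𝓘(ℝ, E →L[ℝ] E)) 𝓘(ℝ, E) (fun b : EndTangent E N ↦ b.proj) (A m)
        (mfderiv 𝓘(ℝ, EM) (𝓘(ℝ, E).prod 𝓘(ℝ, E →L[ℝ] E)) A m v) := congr($hf v)
  have h5 : pullbackDeriv cov (fun m ↦ (A m).proj) (fun m ↦ (A m).snd (s m)) m v =
      e.symmL ℝ x (mvfderiv 𝓘(ℝ, EM) (fun m' ↦ (e ⟨(A m').proj, (A m').snd (s m')⟩).2) m v) +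
        connectionForm cov x (mfderiv 𝓘(ℝ, EM) 𝓘(ℝ, E) (fun m ↦ (A m).proj) m v)
          ((A m).snd (s m)) := rfl
  have h6 : pullbackDeriv cov (fun m ↦ (A m).proj) s m v =
      e.symmL ℝ x (mvfderiv 𝓘(ℝ, EM) (fun m' ↦ (e ⟨(A m').proj, s m'⟩).2) m v) +
        connectionForm cov x (mfderiv 𝓘(ℝ, EM) 𝓘(ℝ, E) (fun m ↦ (A m).proj) m v) (s m) := rfl
  have h7 : connector cov (A m) (mfderiv 𝓘(ℝ, EM) (𝓘(ℝ, E).prod 𝓘(ℝ, E →L[ℝ] E)) A m v) (s m) =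
      e'.symmL ℝ x (mvfderiv 𝓘(ℝ, EM) (fun m' ↦ (e' (A m')).2) m v) (s m) +
        (connectionForm cov x (mfderiv 𝓘(ℝ, EM) 𝓘(ℝ, E) (fun m ↦ (A m).proj) m v)
          ((A m).snd (s m)) - (A m).snd (connectionForm cov x
            (mfderiv 𝓘(ℝ, EM) 𝓘(ℝ, E) (fun m ↦ (A m).proj) m v) (s m))) := by
    rw [h3, h4]; rfl
  have h8 : e.symmL ℝ x ((e' (A m)).2 (mvfderiv 𝓘(ℝ, EM)
      (fun m' ↦ (e ⟨(A m').proj, s m'⟩).2) m v)) = (A m).snd (e.symmL ℝ x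
        (mvfderiv 𝓘(ℝ, EM) (fun m' ↦ (e ⟨(A m').proj, s m'⟩).2) m v)) := by
    have hb : x ∈ e.baseSet := mem_chart_source E x
    have hw : ∀ w : E, (e ⟨x, e.symmL ℝ x w⟩).2 = w := fun w ↦ by
      rw [e.symmL_apply hb, e.apply_mk_symm hb]
    have h := trivializationAt_hom_apply (mem_chart_source E x) (A m).snd (e.symmL ℝ x
        (mvfderiv 𝓘(ℝ, EM) (fun m' ↦ (e ⟨(A m').proj, s m'⟩).2) m v))
    rw [hw] at h
    exact (congrArg (e.symmL ℝ x) h).trans (symmL_trivializationAt_apply _)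
  have h9 : mvfderiv 𝓘(ℝ, EM) (fun m' ↦ (e ⟨(A m').proj, (A m').snd (s m')⟩).2) m v =
      mvfderiv 𝓘(ℝ, EM) (fun m' ↦ (e' (A m')).2) m v (e ⟨(A m).proj, s m⟩).2 +
        (e' (A m)).2 (mvfderiv 𝓘(ℝ, EM) (fun m' ↦ (e ⟨(A m').proj, s m'⟩).2) m v) := h1.trans h2
  -- The frame terms match by the product rule, and ΓAs = (ΓA - AΓ)s + AΓs accounts for the
  -- commutator in `connector`.
  rw [h5, h6, h7, h9, map_add, map_add, h8, symmL_trivializationAt_hom_apply]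
  abel

end Pullback

/-! ### Linearity of the connector, and the pluriharmonicity argument. -/

section Holomorphic

variable {EM : Type*} [NormedAddCommGroup EM] [NormedSpace ℝ EM] [FiniteDimensional ℝ EM]
  {M : Type*} [TopologicalSpace M] [ChartedSpace EM M] [IsManifold 𝓘(ℝ, EM) ∞ M]
  {E : Type*} [NormedAddCommGroup E] [NormedSpace ℝ E] [FiniteDimensional ℝ E]
  {N : Type*} [TopologicalSpace N] [ChartedSpace E N] [IsManifold 𝓘(ℝ, E) ∞ N]

theorem connectionForm_add
    (cov : CovariantDerivative 𝓘(ℝ, E) E (TangentSpace 𝓘(ℝ, E) : N → Type _)) (x : N)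
    (u v : TangentSpace 𝓘(ℝ, E) x) :
    connectionForm cov x (u + v) = connectionForm cov x u + connectionForm cov x v :=
  ContinuousLinearMap.ext fun w ↦ map_add (cov (extend E w) x) u v

theorem connectionForm_smul
    (cov : CovariantDerivative 𝓘(ℝ, E) E (TangentSpace 𝓘(ℝ, E) : N → Type _)) (x : N) (c : ℝ)
    (u : TangentSpace 𝓘(ℝ, E) x) :
    connectionForm cov x (c • u) = c • connectionForm cov x u :=
  ContinuousLinearMap.ext fun w ↦ map_smul (cov (extend E w) x) c u

/-- `connector` is defined as a bare function of the tangent vector; additivity permits splitting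
vectors of the twistor space into horizontal and vertical parts. -/
theorem connector_add
    (cov : CovariantDerivative 𝓘(ℝ, E) E (TangentSpace 𝓘(ℝ, E) : N → Type _))
    (a : EndTangent E N) (ξ η : TangentSpace (𝓘(ℝ, E).prod 𝓘(ℝ, E →L[ℝ] E)) a) :
    connector cov a (ξ + η) = connector cov a ξ + connector cov a η := by
  have h1 := (mvfderiv (𝓘(ℝ, E).prod 𝓘(ℝ, E →L[ℝ] E)) (fun b : EndTangent E N ↦
    (trivializationAt (E →L[ℝ] E) (fun x : N ↦ TangentSpace 𝓘(ℝ, E) x →L[ℝ] TangentSpace 𝓘(ℝ, E) x)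
      a.proj b).2) a).map_add ξ η
  have h2 := (mfderiv (𝓘(ℝ, E).prod 𝓘(ℝ, E →L[ℝ] E)) 𝓘(ℝ, E)
    (fun b : EndTangent E N ↦ b.proj) a).map_add ξ η
  simp only [connector]
  rw [h1, h2, connectionForm_add, ContinuousLinearMap.map_add, ContinuousLinearMap.add_comp,
    ContinuousLinearMap.comp_add]
  abel

theorem connector_smul
    (cov : CovariantDerivative 𝓘(ℝ, E) E (TangentSpace 𝓘(ℝ, E) : N → Type _))
    (a : EndTangent E N) (c : ℝ) (ξ : TangentSpace (𝓘(ℝ, E).prod 𝓘(ℝ, E →L[ℝ] E)) a) :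
    connector cov a (c • ξ) = c • connector cov a ξ := by
  have h1 := (mvfderiv (𝓘(ℝ, E).prod 𝓘(ℝ, E →L[ℝ] E)) (fun b : EndTangent E N ↦
    (trivializationAt (E →L[ℝ] E) (fun x : N ↦ TangentSpace 𝓘(ℝ, E) x →L[ℝ] TangentSpace 𝓘(ℝ, E) x)
      a.proj b).2) a).map_smul c ξ
  have h2 := (mfderiv (𝓘(ℝ, E).prod 𝓘(ℝ, E →L[ℝ] E)) 𝓘(ℝ, E)
    (fun b : EndTangent E N ↦ b.proj) a).map_smul c ξ
  simp only [connector]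
  rw [h1, h2, connectionForm_smul, ContinuousLinearMap.map_smul, ContinuousLinearMap.smul_comp,
    ContinuousLinearMap.comp_smul, smul_add, smul_sub]

/-- A map `f : M → N`, together with an almost complex structure `A` along `f` for which `df` is
complex linear and `∇_{JX} A = -A ∇_X A`, is generalized pluriharmonic with respect to every
torsion-free connection on `N`. -/
theorem secondFundamentalForm_oneOnePart_eq_zero
    {cov : CovariantDerivative 𝓘(ℝ, E) E (TangentSpace 𝓘(ℝ, E) : N → Type _)}
    (hcov : cov.torsion = 0) (J : AlmostComplexStructure EM M)
    {D : CovariantDerivative 𝓘(ℝ, EM) EM (TangentSpace 𝓘(ℝ, EM) : M → Type _)}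
    (hD : IsNijenhuisType J D) {A : M → EndTangent E N}
    (hA : ContMDiff 𝓘(ℝ, EM) (𝓘(ℝ, E).prod 𝓘(ℝ, E →L[ℝ] E)) ∞ A)
    (hf : ContMDiff 𝓘(ℝ, EM) 𝓘(ℝ, E) ∞ (fun m ↦ (A m).proj))
    (hsq : ∀ (m : M) (v : TangentSpace 𝓘(ℝ, E) (A m).proj), (A m).snd ((A m).snd v) = -v)
    (hJ : ∀ (m : M) (v : TangentSpace 𝓘(ℝ, EM) m),
      mfderiv 𝓘(ℝ, EM) 𝓘(ℝ, E) (fun m ↦ (A m).proj) m (J.J m v) =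
        (A m).snd (mfderiv 𝓘(ℝ, EM) 𝓘(ℝ, E) (fun m ↦ (A m).proj) m v))
    (hAJ : ∀ (m : M) (v : TangentSpace 𝓘(ℝ, EM) m),
      connector cov (A m) (mfderiv 𝓘(ℝ, EM) (𝓘(ℝ, E).prod 𝓘(ℝ, E →L[ℝ] E)) A m (J.J m v)) =
        -((A m).snd ∘L
          connector cov (A m) (mfderiv 𝓘(ℝ, EM) (𝓘(ℝ, E).prod 𝓘(ℝ, E →L[ℝ] E)) A m v)))
    {X Y : Π m : M, TangentSpace 𝓘(ℝ, EM) m} {m : M}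
    (hX : MDiffAt (T% X) m) (hY : MDiffAt (T% Y) m) :
    oneOnePart (fun (V : Π x : M, TangentSpace 𝓘(ℝ, EM) x) x ↦ J.J x (V x))
      (secondFundamentalForm D cov (fun m ↦ (A m).proj)) X Y m = 0 := by
  let f : M → N := fun m ↦ (A m).proj
  let Jf : (Π x : M, TangentSpace 𝓘(ℝ, EM) x) → Π x : M, TangentSpace 𝓘(ℝ, EM) x :=
    fun V x ↦ J.J x (V x)
  let j := (A m).snd
  let a := fun v ↦ connector cov (A m) (mfderiv 𝓘(ℝ, EM) (𝓘(ℝ, E).prod 𝓘(ℝ, E →L[ℝ] E)) A m v)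
  let B := fun X Y ↦ secondFundamentalForm D cov f X Y m
  let d := mfderiv 𝓘(ℝ, EM) 𝓘(ℝ, E) f m
  have hf2 : ContMDiffAt 𝓘(ℝ, EM) 𝓘(ℝ, E) 2 f m := (hf m).of_le ENat.LEInfty.out
  have hA1 := (hA m).mdifferentiableAt (by simp)
  have hJd : ∀ {V : Π x : M, TangentSpace 𝓘(ℝ, EM) x}, MDiffAt (T% V) m → MDiffAt (T% (Jf V)) m :=
    fun hV ↦ ((J.smooth m).mdifferentiableAt (by simp)).clm_bundle_apply hV
  -- The covariant derivative of df(JY) = A df(Y), where DJ = 0 lets j be pulled out of the term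
  -- df(D_X (JY)) as well.
  have hB : ∀ X Y, MDiffAt (T% Y) m → B X (Jf Y) = a (X m) (d (Y m)) + j (B X Y) := by
    intro X Y hY
    have h1 : (fun m' ↦ mfderiv 𝓘(ℝ, EM) 𝓘(ℝ, E) f m' (Jf Y m')) =
        fun m' ↦ (A m').snd (mfderiv 𝓘(ℝ, EM) 𝓘(ℝ, E) f m' (Y m')) := funext fun m' ↦ hJ _ _
    have h2 := pullbackDeriv_clm_apply cov hA1 (mdifferentiableAt_mfderiv_apply_snd hf2 hY) (X m)
    have h3 : d (D (Jf Y) m (X m)) = j (d (D Y m (X m))) := by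
      rw [← hJ, ← hD.complex Y m hY]
    change pullbackDeriv cov f (fun m' ↦ mfderiv 𝓘(ℝ, EM) 𝓘(ℝ, E) f m' (Jf Y m')) m (X m) -
      d (D (Jf Y) m (X m)) = a (X m) (d (Y m)) + j (pullbackDeriv cov f
        (fun m' ↦ mfderiv 𝓘(ℝ, EM) 𝓘(ℝ, E) f m' (Y m')) m (X m) - d (D Y m (X m)))
    rw [h1, h3, map_sub, ← add_sub_assoc]
    exact congrArg (· - _) h2
  -- The two derivatives of df differ by df[X, Y], which combines with D_X Y - D_Y X into the
  -- torsion of D.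
  have hS : ∀ X Y, MDiffAt (T% X) m → MDiffAt (T% Y) m →
      B X Y - B Y X = -d (D.torsion m (X m) (Y m)) := by
    intro X Y hX hY
    have h := pullbackDeriv_mfderiv_sub hcov hf2 hX hY
    rw [D.torsion_apply hX hY, map_sub, map_sub, ← h]
    simp only [B, secondFundamentalForm]
    change _ - d _ - (_ - d _) = _
    abel
  have hT : ∀ u v : TangentSpace 𝓘(ℝ, EM) m,
      D.torsion m (J.J m u) (J.J m v) = -D.torsion m u v := by
    intro u v
    have h := hD.torsion m u v
    simp only [oneOnePart] at h
    exact (neg_eq_of_add_eq_zero_right ((smul_eq_zero.1 h).resolve_left (by norm_num))).symm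
  -- The previous identity at (Ju, v), with J² = -1.
  have hT' : ∀ u v : TangentSpace 𝓘(ℝ, EM) m,
      D.torsion m u (J.J m v) = D.torsion m (J.J m u) v := by
    intro u v
    have h := hT (J.J m u) v
    rw [J.sq, map_neg, neg_apply, neg_inj] at h
    exact h
  have haJ : ∀ u w, a (J.J m u) w = -j (a u w) := fun u w ↦ congr($(hAJ m u) w)
  -- the `(1,1)`-part is symmetric, and it is `j (B (J X) Y - B X (J Y))`, which is antisymmetric
  have hC : ∀ X Y, MDiffAt (T% X) m → MDiffAt (T% Y) m →
      B X Y + B (Jf X) (Jf Y) = j (B (Jf X) Y - B X (Jf Y)) := by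
    intro X Y _ hY
    -- Here j (j B(X, Y)) = -B(X, Y), and a(JX) = -j a(X) cancels the two terms containing ∇A.
    rw [hB (Jf X) Y hY, map_sub, hB X Y hY, map_add, hsq]
    change B X Y + (a (J.J m (X m)) _ + _) = _
    rw [haJ]
    abel
  have hsymm : B X Y + B (Jf X) (Jf Y) = B Y X + B (Jf Y) (Jf X) := by
    rw [← sub_eq_zero, add_sub_add_comm, hS X Y hX hY, hS _ _ (hJd hX) (hJd hY)]
    change -d _ + -d (D.torsion m (J.J m (X m)) (J.J m (Y m))) = 0
    rw [hT, map_neg]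
    abel
  have hanti : B (Jf Y) X - B Y (Jf X) = -(B (Jf X) Y - B X (Jf Y)) := by
    have h1 := hS X (Jf Y) hX (hJd hY)
    have h2 := hS (Jf X) Y (hJd hX) hY
    have h3 : D.torsion m (X m) (Jf Y m) = D.torsion m (Jf X m) (Y m) := hT' _ _
    rw [h3, ← h2] at h1
    rw [sub_eq_sub_iff_add_eq_add] at h1
    rw [neg_sub, sub_eq_sub_iff_add_eq_add, add_comm, ← h1]
  have h0 : B X Y + B (Jf X) (Jf Y) = 0 := by
    have h1 := hC X Y hX hY
    have h2 := hC Y X hY hX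
    rw [← hsymm, hanti, map_neg, ← h1] at h2
    rw [eq_neg_iff_add_eq_zero, ← two_smul ℝ] at h2
    exact (smul_eq_zero.1 h2).resolve_left two_ne_zero
  change (1 / 2 : ℝ) • (B X Y + B (Jf X) (Jf Y)) = 0
  rw [h0, smul_zero]

end Holomorphic

/-! ### The horizontal and vertical components of J₂. -/

namespace TwistorSpace

variable {EM : Type*} [NormedAddCommGroup EM] [NormedSpace ℝ EM] [FiniteDimensional ℝ EM]
  {M : Type*} [TopologicalSpace M] [ChartedSpace EM M] [IsManifold 𝓘(ℝ, EM) ∞ M]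
  {E : Type*} [NormedAddCommGroup E] [NormedSpace ℝ E] [FiniteDimensional ℝ E]
  {N : Type*} [TopologicalSpace N] [ChartedSpace E N] [IsManifold 𝓘(ℝ, E) ∞ N]
  [RiemannianBundle (fun x : N ↦ TangentSpace 𝓘(ℝ, E) x)]
  [IsContMDiffRiemannianBundle 𝓘(ℝ, E) ∞ E (fun x : N ↦ TangentSpace 𝓘(ℝ, E) x)]
  {F : Type*} [NormedAddCommGroup F] [NormedSpace ℂ F]
  {Z : Type*} [TopologicalSpace Z] [ChartedSpace F Z] [IsManifold 𝓘(ℂ, F) ω Z]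
  (T : TwistorSpace E N F Z)

theorem dp_lift (z : Z) (w : TangentSpace 𝓘(ℝ, E) (T.p z)) : T.dp z (T.lift z w) = w :=
  (T.horizontalEquiv z).apply_symm_apply w

theorem lift_mem (z : Z) (w : TangentSpace 𝓘(ℝ, E) (T.p z)) : T.lift z w ∈ T.H z :=
  ((T.horizontalEquiv z).symm w).2

theorem dp_sub_lift (z : Z) (v : TangentSpace 𝓘(ℝ, F) z) :
    T.dp z (v - T.lift z (T.dp z v)) = 0 := by
  rw [map_sub, dp_lift, sub_self]

/-- Multiplication by √-1 preserves ker dp because the fibres are complex, so only the horizontal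
part of J₂ survives. -/
theorem dp_J₂ (z : Z) (v : TangentSpace 𝓘(ℝ, F) z) :
    T.dp z (T.J₂ z v) = (T.i z).snd (T.dp z v) := by
  have h : T.dp z (complexMul z (v - T.lift z (T.dp z v))) = 0 :=
    T.complex_fibers z _ (T.dp_sub_lift z v)
  rw [J₂, map_add, map_neg, h, neg_zero, zero_add]
  exact T.dp_lift z _

theorem contMDiff_p : ContMDiff 𝓘(ℝ, F) 𝓘(ℝ, E) ∞ T.p :=
  (contMDiff_proj (n := ∞) (fun x : N ↦ TangentSpace 𝓘(ℝ, E) x →L[ℝ] TangentSpace 𝓘(ℝ, E) x)).comp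
    T.i_smooth

/-- The vertical part of `di`, as a linear map. -/
def verticalDeriv (z : Z) : TangentSpace 𝓘(ℝ, F) z →ₗ[ℝ]
    (TangentSpace 𝓘(ℝ, E) (T.i z).proj →L[ℝ] TangentSpace 𝓘(ℝ, E) (T.i z).proj) where
  toFun v := verticalPart (T.i z) (mfderiv 𝓘(ℝ, F) (𝓘(ℝ, E).prod 𝓘(ℝ, E →L[ℝ] E)) T.i z v)
  map_add' v w := by
    rw [ContinuousLinearMap.map_add]; exact connector_add _ _ _ _
  map_smul' c v := by
    rw [ContinuousLinearMap.map_smul]; exact connector_smul _ _ _ _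

/-- Horizontal vectors contribute nothing, since di sends them to horizontal vectors. On vertical
ones di is complex linear, and J₂ reverses the sign of the fibre structure. -/
theorem verticalDeriv_J₂ (z : Z) (v : TangentSpace 𝓘(ℝ, F) z) :
    T.verticalDeriv z (T.J₂ z v) = -((T.i z).snd ∘L T.verticalDeriv z v) := by
  have h1 : ∀ w, T.verticalDeriv z (T.lift z w) = 0 := fun w ↦ T.i_horizontal z _ (T.lift_mem z w)
  have h2 : T.verticalDeriv z (complexMul z (v - T.lift z (T.dp z v))) =
      (T.i z).snd ∘L T.verticalDeriv z (v - T.lift z (T.dp z v)) :=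
    T.i_holomorphic z _ (T.dp_sub_lift z v)
  have h3 : T.verticalDeriv z (v - T.lift z (T.dp z v)) = T.verticalDeriv z v := by
    rw [map_sub, h1, sub_zero]
  rw [h3] at h2
  rw [J₂, map_add, map_neg, h2]
  exact (congrArg _ (h1 _)).trans (add_zero _)

end TwistorSpace

end TwistorGeom

end

theorem mainTheorem2
    {EM : Type*} [NormedAddCommGroup EM] [NormedSpace ℝ EM] [FiniteDimensional ℝ EM]
    {M : Type*} [TopologicalSpace M] [T2Space M] [SecondCountableTopology M]
    [ChartedSpace EM M] [IsManifold 𝓘(ℝ, EM) ∞ M]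
    (J : AlmostComplexStructure EM M)
    (n : ℕ)
    {EN : Type*} [NormedAddCommGroup EN] [NormedSpace ℝ EN] [FiniteDimensional ℝ EN]
    (hn : Module.finrank ℝ EN = 2 * n)
    {N : Type*} [TopologicalSpace N] [T2Space N] [SecondCountableTopology N]
    [ChartedSpace EN N] [IsManifold 𝓘(ℝ, EN) ∞ N]
    [RiemannianBundle (fun x : N ↦ TangentSpace 𝓘(ℝ, EN) x)]
    [IsContMDiffRiemannianBundle 𝓘(ℝ, EN) ∞ EN (fun x : N ↦ TangentSpace 𝓘(ℝ, EN) x)]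
    {EZ : Type*} [NormedAddCommGroup EZ] [NormedSpace ℂ EZ] [FiniteDimensional ℂ EZ]
    {Z : Type*} [TopologicalSpace Z] [T2Space Z] [SecondCountableTopology Z]
    [ChartedSpace EZ Z] [IsManifold 𝓘(ℂ, EZ) ω Z]
    (T : TwistorSpace EN N EZ Z)
    (ψ : M → Z) (hψ : T.IsJ₂Holomorphic J ψ) :
    IsGeneralizedPluriharmonic (E := EN) (N := N) J (fun x ↦ T.p (ψ x)) := by
  have hφ : ContMDiff 𝓘(ℝ, EM) 𝓘(ℝ, EN) ∞ (fun x ↦ T.p (ψ x)) := T.contMDiff_p.comp hψ.smooth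
  refine ⟨hφ, fun D hD X Y hX hY x ↦ ?_⟩
  -- The almost complex structure along φ is i ∘ ψ. The two goals left are the horizontal and
  -- vertical halves of dψ ∘ J = J₂ ∘ dψ.
  refine secondFundamentalForm_oneOnePart_eq_zero leviCivita_torsion J hD
    (A := fun x ↦ T.i (ψ x)) (T.i_smooth.comp hψ.smooth) hφ (fun m ↦ (T.i_mem (ψ m)).1) ?_ ?_
    ((hX x).mdifferentiableAt (by simp)) ((hY x).mdifferentiableAt (by simp))
  · intro m v
    have h : mfderiv 𝓘(ℝ, EM) 𝓘(ℝ, EN) (fun x ↦ T.p (ψ x)) m =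
        T.dp (ψ m) ∘L mfderiv 𝓘(ℝ, EM) 𝓘(ℝ, EZ) ψ m :=
      mfderiv_comp m ((T.contMDiff_p _).mdifferentiableAt (by simp))
        ((hψ.smooth m).mdifferentiableAt (by simp))
    have h1 := (congrArg (T.dp (ψ m)) (hψ.holomorphic m v)).trans (T.dp_J₂ _ _)
    exact (congr($h (J.J m v)).trans h1).trans (congrArg _ congr($h v).symm)
  · intro m v
    have h := mfderiv_comp m ((T.i_smooth (ψ m)).mdifferentiableAt (by simp))
        ((hψ.smooth m).mdifferentiableAt (by simp))
    have h1 := (congrArg (T.verticalDeriv (ψ m)) (hψ.holomorphic m v)).trans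
      (T.verticalDeriv_J₂ _ _)
    have h2 : ∀ v, connector (leviCivita EN N) (T.i (ψ m)) (mfderiv 𝓘(ℝ, EM)
        (𝓘(ℝ, EN).prod 𝓘(ℝ, EN →L[ℝ] EN)) (fun x ↦ T.i (ψ x)) m v) =
          T.verticalDeriv (ψ m) (mfderiv 𝓘(ℝ, EM) 𝓘(ℝ, EZ) ψ m v) := fun v ↦
      congrArg (connector (leviCivita EN N) (T.i (ψ m))) congr($h v)
    rw [h2, h2]
    exact h1
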